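/- Fix $\sigma_x,\sigma_w,\sigma_\varepsilon\ge 0$, $\kappa>0$ and $b\in\mathbb{R}$. **Model.** Let $n,p\ge1$ and $k\ge0$ be integers and let $x_i,w_i\in\mathbb{R}^p$, $\varepsilon_i\in\mathbb{R}$ ($i=1,\dots,n$) be random, where the samples $(x_i)_i$, $(w_i)_i$, $(\varepsilon_i)_i$ are mutually independent and each consists of independent, mean-zero terms. All $x_i$ have covariance matrix $\Sigma_x$ and all $w_i$ have covariance matrix $\Sigma_w$. They are sub-Gaussian: $\mathbb{E}e^{t v^Tx_i}\le e^{\sigma_x^2t^2/2}$ and $\mathbb{E}e^{t v^Tw_i}\le e^{\sigma_w^2t^2/2}$ for all $\|v\|_2=1$, $t\in\mathbb{R}$, and $\mathbb{E}e^{t\varepsilon_i}\le e^{\sigma_\varepsilon^2t^2/2}$ for all $t\in\mathbb{R}$. Assume $\lambda_{\min}(\Sigma_x)\ge\kappa$. Let $\beta^*\in\mathbb{R}^p$ have support $S=\{j:\beta^*_j\neq0\}$ with $|S|\le k$, and let $\|\beta^*\|_2\le b$. One observes $y_i=x_i^T\beta^*+\varepsilon_i$ and $z_i=x_i+w_i$.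 Let $Z$ be the matrix with rows $z_i^T$, put $$\widehat\Gamma=\frac{Z^TZ}{n}-\Sigma_w,\qquad \widehat\gamma=\frac{Z^Ty}{n},\qquad \mathcal{L}_n(\beta)=\tfrac12\beta^T\widehat\Gamma\beta-\widehat\gamma^T\beta,$$ and consider the (in general nonconvex) program $$\min_{\|\beta\|_1\le R}\ \{\mathcal{L}_n(\beta)+\lambda\|\beta\|_1\}.\qquad(*)$$ A point $\tilde\beta$ with $\|\tilde\beta\|_1\le R$ is a *stationary point* of $(*)$ if, with $\rho(u)=\lambda|u|$, $$\langle\nabla\mathcal{L}_n(\tilde\beta),\beta-\tilde\beta\rangle+\lim_{t\to0^+}\sum_{j}\rho'\big(\tilde\beta_j+t(\beta_j-\tilde\beta_j)\big)(\beta_j-\tilde\beta_j)\ \ge\ 0\quad\text{for all }\|\beta\|_1\le R,$$ where coordinates with $\beta_j=\tilde\beta_j$ contribute $0$. Write $|\!|\!|A|\!|\!|_\infty$ for the $\ell_\infty$-operator norm (maximal absolute row sum). **Theorem.** There are constants $c_0,c_1,c_2,c_3>0$ depending only on $(\sigma_x,\sigma_w,\sigma_\varepsilon,\kappa,b)$ and,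 for every $\eta<1$, constants $c_\ell,c_u>0$ depending in addition only on $\eta$, such that the following holds for all $n,p,k$, all models as above, all $R>0$, and all real $\lambda$ and $c_\infty$. Suppose $$n\ge k^2,\qquad n\ge c_0\,k\log p,\qquad \|\beta^*\|_1\le\frac R2,\qquad c_\ell\sqrt{\frac{\log p}{n}}\le\lambda\le\frac{c_u}{R}.$$ Then there is an event of probability at least $1-c_1\exp(-c_2\min\{k,\log p\})$ on which the following implication holds. If $\widehat\Gamma_{SS}$ is invertible, $$|\!|\!|\widehat\Gamma_{SS}^{-1}|\!|\!|_\infty\le c_\infty\qquad\text{and}\qquad |\!|\!|\widehat\Gamma_{S^cS}\widehat\Gamma_{SS}^{-1}|\!|\!|_\infty\le\eta,$$ then $(*)$ has exactly one stationary point $\widehat\beta$, this $\widehat\beta$ is also the unique global optimum of $(*)$, $\operatorname{supp}(\widehat\beta)\subseteq S$, and $$\|\widehat\beta-\beta^*\|_\infty\le c_3\sqrt{\frac{\log p}{n}}+c_\infty\lambda.$$ -/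

import Mathlib

open MeasureTheory ProbabilityTheory Filter Topology
open scoped Matrix NNReal

noncomputable section

namespace CorruptedLasso

/-- The `ℓ∞`-operator norm of a real matrix (the largest `ℓ¹`-norm of a row). -/
def opNormInf {m l : Type*} [Fintype m] [Fintype l] (A : Matrix m l ℝ) : ℝ :=
  @norm _ (Matrix.linftyOpNormedAddCommGroup).toNorm A

/-- The `ℓ¹`-norm of a vector. -/
def l1Norm {p : ℕ} (v : Fin p → ℝ) : ℝ := ∑ j, |v j|

/-- The support of a vector. -/
def supp {p : ℕ} (v : Fin p → ℝ) : Finset (Fin p) :=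
  haveI := Classical.decPred fun j => v j ≠ 0
  Finset.univ.filter fun j => v j ≠ 0

/-- The random vectors `X 0, …, X (n-1)` are the rows of a sub-Gaussian random matrix with
parameters `(C, σ²)`: they are independent, have mean zero and common covariance matrix `C`, and
every one-dimensional marginal `⟨v, X i⟩`, `‖v‖₂ = 1`, satisfies
`E exp (t ⟨v, X i⟩) ≤ exp (σ² t² / 2)` for all real `t`. -/
structure SubGaussianRows {Ω : Type*} [MeasurableSpace Ω] (P : Measure Ω) {n p : ℕ}
    (X : Fin n → Ω → Fin p → ℝ) (C : Matrix (Fin p) (Fin p) ℝ) (σ : ℝ≥0) : Prop where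
  measurable : ∀ i, Measurable (X i)
  indep : iIndepFun X P
  mean_zero : ∀ i j, ∫ ω, X i ω j ∂P = 0
  covariance_eq : ∀ i j l, covariance (fun ω => X i ω j) (fun ω => X i ω l) P = C j l
  subgaussian : ∀ i (v : Fin p → ℝ), v ⬝ᵥ v = 1 →
    HasSubgaussianMGF (fun ω => v ⬝ᵥ X i ω) (σ ^ 2) P

/-- The errors-in-variables model: the covariates `x i`, the covariate noise `w i` and the
observation noise `ε i` are sub-Gaussian, and the three samples are mutually independent. -/
structure ErrorsInVariables {Ω : Type*} [MeasurableSpace Ω] (P : Measure Ω) {n p : ℕ}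
    (X W : Fin n → Ω → Fin p → ℝ) (ε : Fin n → Ω → ℝ)
    (covX covW : Matrix (Fin p) (Fin p) ℝ) (σx σw σε : ℝ≥0) : Prop where
  covariates : SubGaussianRows P X covX σx
  corruption : SubGaussianRows P W covW σw
  noise_measurable : ∀ i, Measurable (ε i)
  noise_indep : iIndepFun ε P
  noise_subgaussian : ∀ i, HasSubgaussianMGF (ε i) (σε ^ 2) P
  indep_covariates_corruption : IndepFun (fun ω i => X i ω) (fun ω i => W i ω) P
  indep_noise : IndepFun (fun ω => ((fun i => X i ω), (fun i => W i ω))) (fun ω i => ε i ω) P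

/-- The matrix `Z` of observed covariates, with rows `z i = x i + w i`. -/
def observedDesign {Ω : Type*} {n p : ℕ} (X W : Fin n → Ω → Fin p → ℝ) (ω : Ω) :
    Matrix (Fin n) (Fin p) ℝ :=
  Matrix.of fun i j => X i ω j + W i ω j

/-- The responses `y i = ⟨x i, β*⟩ + ε i`. -/
def response {Ω : Type*} {n p : ℕ} (X : Fin n → Ω → Fin p → ℝ) (ε : Fin n → Ω → ℝ)
    (βs : Fin p → ℝ) (ω : Ω) : Fin n → ℝ :=
  fun i => X i ω ⬝ᵥ βs + ε i ω

/-- The corrected Gram matrix `Zᵀ Z / n - Σ_w`. -/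
def gammaMat {n p : ℕ} (Z : Matrix (Fin n) (Fin p) ℝ) (covW : Matrix (Fin p) (Fin p) ℝ) :
    Matrix (Fin p) (Fin p) ℝ :=
  (n : ℝ)⁻¹ • (Zᵀ * Z) - covW

/-- The vector `Zᵀ y / n`. -/
def gammaVec {n p : ℕ} (Z : Matrix (Fin n) (Fin p) ℝ) (y : Fin n → ℝ) : Fin p → ℝ :=
  (n : ℝ)⁻¹ • (Zᵀ *ᵥ y)

/-- The quadratic loss `½ βᵀ Γ β - γᵀ β`. -/
def quadLoss {p : ℕ} (Γ : Matrix (Fin p) (Fin p) ℝ) (γ : Fin p → ℝ) (β : Fin p → ℝ) : ℝ :=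
  (1 / 2) * (β ⬝ᵥ (Γ *ᵥ β)) - γ ⬝ᵥ β

/-- `b` is a global optimum of `min { L β + ∑ j, ρ (β j) : ‖β‖₁ ≤ R }`. -/
def IsGlobalOptimum {p : ℕ} (L : (Fin p → ℝ) → ℝ) (ρ : ℝ → ℝ) (R : ℝ) (b : Fin p → ℝ) : Prop :=
  l1Norm b ≤ R ∧ ∀ β, l1Norm β ≤ R → L b + ∑ j, ρ (b j) ≤ L β + ∑ j, ρ (β j)

/-- `b` is a stationary point of `min { L β + ∑ j, ρ (β j) : ‖β‖₁ ≤ R }`: it is feasible, and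
`⟨∇L(b), β - b⟩ + D ≥ 0` for every feasible `β`, where
`D = lim_{t → 0+} ⟨∇ρ(b + t (β - b)), β - b⟩`. A coordinate in which `β` and `b` agree contributes
nothing to `D`, so that the value of `deriv ρ` at a kink of `ρ` at zero plays no role. -/
def IsStationaryPoint {p : ℕ} (L : (Fin p → ℝ) → ℝ) (ρ : ℝ → ℝ) (R : ℝ) (b : Fin p → ℝ) : Prop :=
  l1Norm b ≤ R ∧ ∀ β, l1Norm β ≤ R → ∃ D : ℝ,
    Tendsto (fun t : ℝ => ∑ j, deriv ρ (b j + t * (β j - b j)) * (β j - b j)) (𝓝[>] 0) (𝓝 D) ∧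
    0 ≤ fderiv ℝ L b (β - b) + D

end CorruptedLasso

end

open CorruptedLasso

/-! The argument is a primal-dual witness construction on top of concentration inequalities. `Γ̂`
may be indefinite, so convexity is replaced by the restricted eigenvalue bound `vᵀΓ̂v ≥ α‖v‖₂² -
τ‖v‖₁²` with `α = κ/2` and `τ` of order `log p / n`.

Deterministic part (`lasso_unique_of_deterministic`). Let `b` minimize the penalized loss over
vectors supported in `S` inside the `ℓ¹`-ball. It is interior to the ball, so the KKT equations hold
on `S`, and the incoherence bound makes the gradient strictly smaller than `λ` off `S`. Stationary
points and global optima both satisfy a first-order variational inequality. Compare such a point `β`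
with `b` and put `ν = β - b`: the strict dual gap controls `‖ν_{Sᶜ}‖₁`. Since `‖ν_{Sᶜ}‖₁ ≤ 2R`, the
bound `λ ≤ c_u/R` lets this gap absorb the negative term `τ‖ν‖₁²`, so `ν = 0` (`eq_of_variational`).

Sup-norm error. On `S`, `b - β*` equals `Γ̂_SS⁻¹e + Γ̂_SS⁻¹g` with `e = γ̂ - Γ̂β*` and `g` the
gradient at `b`. The second term is at most `c_∞λ`. Bounding the first by `c_∞‖e‖_∞` would put `c_∞`
into `c₃`, so `Γ̂_SS⁻¹e` is compared with `Σ_SS⁻¹e`. The entries of the latter are fixed linear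
forms of `e`, and the difference is small in `ℓ²` because `n ≥ k²` (`abs_restricted_solution_le`).

Probability. All random quantities are means of products of two sub-Gaussian variables, which obey a
Bernstein bound (`measure_mean_mul_deviation_le`). A lattice net makes it uniform over sparse
vectors (`measure_sparse_deviation_le`), and a derandomized Maurey argument passes from sparse
vectors to all vectors (`quadForm_ge_of_sparse_nonneg`). -/

namespace CorruptedLasso

/-! ### Bernstein inequality for products of sub-Gaussian variables. -/

section Bernstein

variable {Ω : Type*} [MeasurableSpace Ω] {P : Measure Ω}

theorem hasSubgaussianMGF_mono {A : Ω → ℝ} {c d : ℝ≥0} (h : HasSubgaussianMGF A c P)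
    (hcd : c ≤ d) : HasSubgaussianMGF A d P where
  integrable_exp_mul := h.integrable_exp_mul
  mgf_le t := (h.mgf_le t).trans <| by
    have : (c : ℝ) ≤ d := hcd
    gcongr

theorem integrable_exp_sq_gaussianReal :
    Integrable (fun x : ℝ => Real.exp (x ^ 2 / 4)) (gaussianReal 0 1) := by
  rw [gaussianReal_of_var_ne_zero 0 one_ne_zero]
  rw [integrable_withDensity_iff (measurable_gaussianPDF 0 1)
    (ae_of_all _ fun x => gaussianPDF_lt_top)]
  have h := (integrable_exp_neg_mul_sq (b := 1 / 4) (by norm_num)).const_mul (√(2 * Real.pi))⁻¹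
  refine h.congr (ae_of_all _ fun x => ?_)
  simp only [toReal_gaussianPDF, gaussianPDFReal]
  rw [mul_comm, mul_comm (Real.exp (x ^ 2 / 4)), mul_assoc, ← Real.exp_add, mul_comm]
  simp
  ring_nf
  simp

/-- The Gaussian expectation `E exp (g² / 4)`. -/
noncomputable def gaussianExpSq : ℝ := ∫ x, Real.exp (x ^ 2 / 4) ∂(gaussianReal 0 1)

theorem gaussianExpSq_nonneg : 0 ≤ gaussianExpSq :=
  integral_nonneg fun _ => (Real.exp_pos _).le

/-- Gaussian linearization: `exp (a² / (4c))` is the moment generating function of a standard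
Gaussian `g` at `a / √(2c)`. After exchanging the integrals, the sub-Gaussian bound for `A` at `g /
√(2c)` leaves `exp (g² / 4)`. -/
theorem lintegral_exp_sq_le [IsProbabilityMeasure P] {A : Ω → ℝ} (hA : Measurable A) {c : ℝ≥0}
    (hc : 0 < c) (h : HasSubgaussianMGF A c P) :
    ∫⁻ ω, ENNReal.ofReal (Real.exp (A ω ^ 2 / (4 * c))) ∂P ≤ ENNReal.ofReal gaussianExpSq := by
  have hc' : (0 : ℝ) < c := hc
  set r : ℝ := (√(2 * c))⁻¹ with hr
  have hr2 : r ^ 2 = (2 * c : ℝ)⁻¹ := by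
    rw [hr, inv_pow, Real.sq_sqrt (by positivity)]
  have key : ∀ a : ℝ, ENNReal.ofReal (Real.exp (a ^ 2 / (4 * c)))
      = ∫⁻ g, ENNReal.ofReal (Real.exp (r * a * g)) ∂(gaussianReal 0 1) := by
    intro a
    rw [← ofReal_integral_eq_lintegral_ofReal (integrable_exp_mul_gaussianReal _)
      (ae_of_all _ fun _ => (Real.exp_pos _).le)]
    have := congrFun (mgf_id_gaussianReal (μ := 0) (v := 1)) (r * a)
    simp only [mgf, id] at this
    rw [this]
    congr 2
    simp only [NNReal.coe_one, mul_pow, hr2]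
    field_simp
    ring
  simp_rw [key]
  rw [lintegral_lintegral_swap (by fun_prop)]
  rw [gaussianExpSq, ofReal_integral_eq_lintegral_ofReal integrable_exp_sq_gaussianReal
      (ae_of_all _ fun _ => (Real.exp_pos _).le)]
  refine lintegral_mono fun g => ?_
  have h1 : (fun ω => ENNReal.ofReal (Real.exp (r * A ω * g)))
      = fun ω => ENNReal.ofReal (Real.exp ((r * g) * A ω)) := by
    ext ω; ring_nf
  rw [h1, ← ofReal_integral_eq_lintegral_ofReal (h.integrable_exp_mul _)
      (ae_of_all _ fun _ => (Real.exp_pos _).le)]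
  refine ENNReal.ofReal_le_ofReal ((h.mgf_le (r * g)).trans (le_of_eq ?_))
  rw [mul_pow, hr2]
  congr 1
  field_simp
  ring

/-- By `|AB| ≤ (A² + B²) / 2` and convexity of `exp`, the product inherits the square-exponential
bound of its factors. No independence of `A` and `B` is needed, which matters because both factors
involve the same observation. -/
theorem exp_abs_mul_bound [IsProbabilityMeasure P] {A B : Ω → ℝ} (hA : Measurable A)
    (hB : Measurable B) {c : ℝ≥0} (hc : 0 < c) (h : HasSubgaussianMGF A c P)
    (h' : HasSubgaussianMGF B c P) :
    Integrable (fun ω => Real.exp ((4 * c)⁻¹ * |A ω * B ω|)) P ∧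
      ∫ ω, Real.exp ((4 * c)⁻¹ * |A ω * B ω|) ∂P ≤ gaussianExpSq := by
  have hc' : (0 : ℝ) < c := hc
  have hint : ∀ {A : Ω → ℝ}, Measurable A → HasSubgaussianMGF A c P →
      Integrable (fun ω => Real.exp (A ω ^ 2 / (4 * c))) P ∧
      ∫ ω, Real.exp (A ω ^ 2 / (4 * c)) ∂P ≤ gaussianExpSq := by
    intro A hA h
    have hle := lintegral_exp_sq_le hA hc h
    have hi : Integrable (fun ω => Real.exp (A ω ^ 2 / (4 * c))) P := by
      refine ⟨by fun_prop, ?_⟩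
      rw [hasFiniteIntegral_iff_ofReal (ae_of_all _ fun _ => (Real.exp_pos _).le)]
      exact hle.trans_lt ENNReal.ofReal_lt_top
    refine ⟨hi, ?_⟩
    rw [← ENNReal.ofReal_le_ofReal_iff gaussianExpSq_nonneg,
      ofReal_integral_eq_lintegral_ofReal hi (ae_of_all _ fun _ => (Real.exp_pos _).le)]
    exact hle
  obtain ⟨iA, bA⟩ := hint hA h
  obtain ⟨iB, bB⟩ := hint hB h'
  have hpt : ∀ ω, Real.exp ((4 * c)⁻¹ * |A ω * B ω|)
      ≤ (1 / 2) * Real.exp (A ω ^ 2 / (4 * c)) + (1 / 2) * Real.exp (B ω ^ 2 / (4 * c)) := by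
    intro ω
    have h1 : (4 * c : ℝ)⁻¹ * |A ω * B ω|
        ≤ (1 / 2) * (A ω ^ 2 / (4 * c)) + (1 / 2) * (B ω ^ 2 / (4 * c)) := by
      rw [abs_mul]
      have : |A ω| * |B ω| ≤ (A ω ^ 2 + B ω ^ 2) / 2 := by
        nlinarith [sq_nonneg (|A ω| - |B ω|), sq_abs (A ω), sq_abs (B ω)]
      calc (4 * c : ℝ)⁻¹ * (|A ω| * |B ω|) ≤ (4 * c : ℝ)⁻¹ * ((A ω ^ 2 + B ω ^ 2) / 2) := by gcongr
        _ = _ := by field_simp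
    refine (Real.exp_le_exp.2 h1).trans ?_
    exact convexOn_exp.2 (Set.mem_univ (A ω ^ 2 / (4 * c : ℝ)))
      (Set.mem_univ (B ω ^ 2 / (4 * c : ℝ))) (show (0 : ℝ) ≤ 1 / 2 by norm_num)
      (show (0 : ℝ) ≤ 1 / 2 by norm_num) (by norm_num)
  have isum := (iA.const_mul (1 / 2)).add (iB.const_mul (1 / 2))
  have hi : Integrable (fun ω => Real.exp ((4 * c)⁻¹ * |A ω * B ω|)) P := by
    refine isum.mono' (by fun_prop) (ae_of_all _ fun ω => ?_)
    rw [Real.norm_eq_abs, Real.abs_exp]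
    exact hpt ω
  refine ⟨hi, (integral_mono hi isum hpt).trans ?_⟩
  simp only [Pi.add_apply]
  rw [integral_add (iA.const_mul _) (iB.const_mul _), integral_const_mul, integral_const_mul]
  linarith

theorem exp_le_one_add_add_sq_mul_exp_abs (x : ℝ) :
    Real.exp x ≤ 1 + x + x ^ 2 * Real.exp |x| := by
  have h := Complex.norm_exp_sub_sum_le_norm_mul_exp (x : ℂ) 2
  simp only [Finset.sum_range_succ, Finset.range_zero, Finset.sum_empty, pow_zero,
    Nat.factorial, pow_one] at h
  have h2 : Complex.exp x - (0 + 1 / ((1 : ℕ) : ℂ) + (x : ℂ) / (((0 + 1) * 1 : ℕ) : ℂ))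
      = ((Real.exp x - (1 + x) : ℝ) : ℂ) := by
    push_cast; simp
  rw [h2, Complex.norm_real, Complex.norm_real, Real.norm_eq_abs, Real.norm_eq_abs, sq_abs] at h
  linarith [le_abs_self (Real.exp x - (1 + x))]

/-- Half of the exponential moment pays for `U² ≤ (8 / r²) exp (r|U| / 2)`, the other half for `exp
|sU|`. The mean stays in the exponent, so `U` need not be centred. -/
theorem mgf_le_of_exp_abs [IsProbabilityMeasure P] {U : Ω → ℝ} (hU : Measurable U) {r M : ℝ}
    (hr : 0 < r) (hi : Integrable (fun ω => Real.exp (r * |U ω|)) P)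
    (hM : ∫ ω, Real.exp (r * |U ω|) ∂P ≤ M) {s : ℝ} (hs : |s| ≤ r / 2) :
    Integrable (fun ω => Real.exp (s * U ω)) P ∧
      mgf U P s ≤ Real.exp (s * ∫ ω, U ω ∂P + 8 * M / r ^ 2 * s ^ 2) := by
  have hsU : ∀ ω, |s * U ω| ≤ r / 2 * |U ω| := fun ω => by
    rw [abs_mul]; gcongr
  have hie : Integrable (fun ω => Real.exp (s * U ω)) P := by
    refine hi.mono' (by fun_prop) (ae_of_all _ fun ω => ?_)
    rw [Real.norm_eq_abs, Real.abs_exp, Real.exp_le_exp]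
    nlinarith [le_abs_self (s * U ω), hsU ω, abs_nonneg (U ω)]
  have hiU : Integrable U P := by
    refine (hi.const_mul r⁻¹).mono' (by fun_prop) (ae_of_all _ fun ω => ?_)
    rw [Real.norm_eq_abs, inv_mul_eq_div, le_div_iff₀ hr]
    linarith [Real.add_one_le_exp (r * |U ω|)]
  have hpt : ∀ ω, Real.exp (s * U ω)
      ≤ 1 + s * U ω + 8 / r ^ 2 * s ^ 2 * Real.exp (r * |U ω|) := by
    intro ω
    refine (exp_le_one_add_add_sq_mul_exp_abs _).trans ?_
    have h0 : 0 ≤ r / 2 * |U ω| := by positivity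
    have h1 : (r / 2 * |U ω|) ^ 2 / 2 ≤ Real.exp (r / 2 * |U ω|) := by
      linarith [Real.quadratic_le_exp_of_nonneg h0]
    have h2 : U ω ^ 2 ≤ 8 / r ^ 2 * Real.exp (r / 2 * |U ω|) := by
      rw [mul_pow, sq_abs] at h1
      rw [div_mul_eq_mul_div, le_div_iff₀ (by positivity)]
      linarith
    have h3 : Real.exp |s * U ω| ≤ Real.exp (r / 2 * |U ω|) := Real.exp_le_exp.2 (hsU ω)
    have h4 : Real.exp (r * |U ω|) = Real.exp (r / 2 * |U ω|) * Real.exp (r / 2 * |U ω|) := by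
      rw [← Real.exp_add]; ring_nf
    rw [h4, mul_pow]
    have : s ^ 2 * U ω ^ 2 * Real.exp |s * U ω| ≤ s ^ 2 * (8 / r ^ 2 * Real.exp (r / 2 * |U ω|))
        * Real.exp (r / 2 * |U ω|) := by gcongr
    linarith
  refine ⟨hie, ?_⟩
  have i1 : Integrable (fun ω => 1 + s * U ω) P := (integrable_const _).add (hiU.const_mul _)
  have i2 := hi.const_mul (8 / r ^ 2 * s ^ 2)
  calc mgf U P s ≤ ∫ ω, (1 + s * U ω + 8 / r ^ 2 * s ^ 2 * Real.exp (r * |U ω|)) ∂P :=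
        integral_mono hie (i1.add i2) hpt
    _ = 1 + s * ∫ ω, U ω ∂P + 8 / r ^ 2 * s ^ 2 * ∫ ω, Real.exp (r * |U ω|) ∂P := by
        rw [integral_add i1 i2, integral_add (integrable_const _) (hiU.const_mul _),
          integral_const_mul, integral_const_mul]
        simp
    _ ≤ 1 + (s * ∫ ω, U ω ∂P + 8 / r ^ 2 * s ^ 2 * M) := by
        rw [add_assoc]; gcongr
    _ ≤ Real.exp (s * ∫ ω, U ω ∂P + 8 / r ^ 2 * s ^ 2 * M) := by
        rw [add_comm]; exact Real.add_one_le_exp _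
    _ = _ := by congr 1; ring

/-- One-sided Bernstein bound for sums of independent variables with a local quadratic bound on
the cumulant generating function. -/
theorem measure_sum_ge_le_of_mgf_le [IsProbabilityMeasure P] {n : ℕ} {U : Fin n → Ω → ℝ}
    (hU : ∀ i, Measurable (U i)) (hind : iIndepFun U P) {μ K θ : ℝ} (hθ : 0 < θ)
    (hi : ∀ i s, |s| ≤ θ → Integrable (fun ω => Real.exp (s * U i ω)) P)
    (hm : ∀ i s, |s| ≤ θ → mgf (U i) P s ≤ Real.exp (s * μ + K * s ^ 2))
    {t : ℝ} (ht0 : 0 ≤ t) (ht1 : t ≤ 1) :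
    P.real {ω | n * (μ + (1 + K * θ ^ 2) / θ * t) ≤ ∑ i, U i ω} ≤ Real.exp (-(n * t ^ 2)) ∧
    P.real {ω | ∑ i, U i ω ≤ n * (μ - (1 + K * θ ^ 2) / θ * t)} ≤ Real.exp (-(n * t ^ 2)) := by
  -- Chernoff's bound is used at `±θt`. The factor `(1 + Kθ²) / θ` is chosen so that, after the term
  -- `Kθ²t²` is absorbed, the exponent is exactly `-n t²`.
  have hs : |θ * t| ≤ θ := by
    rw [abs_of_nonneg (by positivity)]; nlinarith
  have hmgf : ∀ s, |s| ≤ θ → mgf (∑ i, U i) P s ≤ Real.exp (n * (s * μ + K * s ^ 2)) := by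
    intro s hs
    rw [hind.mgf_sum hU]
    calc ∏ i, mgf (U i) P s ≤ ∏ _i : Fin n, Real.exp (s * μ + K * s ^ 2) :=
          Finset.prod_le_prod (fun i _ => mgf_nonneg) fun i _ => hm i s hs
      _ = _ := by
          rw [Finset.prod_const, Finset.card_univ, Fintype.card_fin, ← Real.exp_nat_mul]
  have hint : ∀ s, |s| ≤ θ → Integrable (fun ω => Real.exp (s * (∑ i, U i) ω)) P := fun s hs =>
    hind.integrable_exp_mul_sum hU fun i _ => hi i s hs
  constructor
  · have h := measure_ge_le_exp_mul_mgf (X := ∑ i, U i) (μ := P)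
      (n * (μ + (1 + K * θ ^ 2) / θ * t)) (t := θ * t) (by positivity) (hint _ hs)
    simp only [Finset.sum_apply] at h
    refine h.trans ((mul_le_mul_of_nonneg_left (hmgf _ hs) (Real.exp_pos _).le).trans (le_of_eq ?_))
    rw [← Real.exp_add]
    congr 1
    field_simp
    ring
  · have hs' : |(-(θ * t))| ≤ θ := by rwa [abs_neg]
    have h := measure_le_le_exp_mul_mgf (X := ∑ i, U i) (μ := P)
      (n * (μ - (1 + K * θ ^ 2) / θ * t)) (t := -(θ * t)) (by
        have : 0 ≤ θ * t := by positivity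
        linarith) (hint _ hs')
    simp only [Finset.sum_apply] at h
    refine h.trans ((mul_le_mul_of_nonneg_left (hmgf _ hs') (Real.exp_pos _).le).trans
      (le_of_eq ?_))
    rw [← Real.exp_add]
    congr 1
    field_simp
    ring

/-- The scale of the deviations of a mean of products of two sub-Gaussian variables. -/
noncomputable def productScale (c : ℝ≥0) : ℝ :=
  (1 + 8 * gaussianExpSq / ((4 * c : ℝ)⁻¹) ^ 2 * ((4 * c : ℝ)⁻¹ / 2) ^ 2) / ((4 * c : ℝ)⁻¹ / 2)

theorem productScale_pos {c : ℝ≥0} (hc : 0 < c) : 0 < productScale c := by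
  have := gaussianExpSq_nonneg
  have hc' : (0 : ℝ) < c := hc
  unfold productScale
  positivity

theorem measure_mean_mul_deviation_le [IsProbabilityMeasure P] {n : ℕ} (hn : 0 < n)
    {A B : Fin n → Ω → ℝ}
    (hA : ∀ i, Measurable (A i)) (hB : ∀ i, Measurable (B i)) {c : ℝ≥0} (hc : 0 < c)
    (h : ∀ i, HasSubgaussianMGF (A i) c P) (h' : ∀ i, HasSubgaussianMGF (B i) c P)
    (hind : iIndepFun (fun i ω => A i ω * B i ω) P) {μ : ℝ}
    (hμ : ∀ i, ∫ ω, A i ω * B i ω ∂P = μ) {t : ℝ} (ht0 : 0 ≤ t) (ht1 : t ≤ 1) :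
    P.real {ω | productScale c * t < |(n : ℝ)⁻¹ * ∑ i, A i ω * B i ω - μ|}
      ≤ 2 * Real.exp (-(n * t ^ 2)) := by
  have hc' : (0 : ℝ) < c := hc
  have hb := fun i => exp_abs_mul_bound (hA i) (hB i) hc (h i) (h' i)
  have hr : (0 : ℝ) < (4 * c : ℝ)⁻¹ := by positivity
  have hm := fun i (s : ℝ) (hs : |s| ≤ (4 * c : ℝ)⁻¹ / 2) =>
    mgf_le_of_exp_abs ((hA i).mul (hB i)) hr (hb i).1 (hb i).2 hs
  simp only [Pi.mul_apply] at hm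
  obtain ⟨h1, h2⟩ := measure_sum_ge_le_of_mgf_le (U := fun i ω => A i ω * B i ω)
    (fun i => (hA i).mul (hB i)) hind (μ := μ) (K := 8 * gaussianExpSq / ((4 * c : ℝ)⁻¹) ^ 2)
    (half_pos hr) (fun i s hs => (hm i s hs).1)
    (fun i s hs => by rw [← hμ i]; exact (hm i s hs).2) ht0 ht1
  have hn' : (0 : ℝ) < n := by exact_mod_cast hn
  change P.real {ω | n * (μ + productScale c * t) ≤ ∑ i, A i ω * B i ω} ≤ _ at h1
  change P.real {ω | ∑ i, A i ω * B i ω ≤ n * (μ - productScale c * t)} ≤ _ at h2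
  have hsub : {ω | productScale c * t < |(n : ℝ)⁻¹ * ∑ i, A i ω * B i ω - μ|} ⊆
      {ω | n * (μ + productScale c * t) ≤ ∑ i, A i ω * B i ω} ∪
      {ω | ∑ i, A i ω * B i ω ≤ n * (μ - productScale c * t)} := by
    intro ω hω
    simp only [Set.mem_ofPred_eq, Set.mem_union] at hω ⊢
    rcases lt_abs.1 hω with h | h
    · left
      have : μ + productScale c * t ≤ (n : ℝ)⁻¹ * ∑ i, A i ω * B i ω := by linarith
      rwa [inv_mul_eq_div, le_div_iff₀ hn', mul_comm] at this
    · right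
      have : (n : ℝ)⁻¹ * ∑ i, A i ω * B i ω ≤ μ - productScale c * t := by linarith
      rwa [inv_mul_eq_div, div_le_iff₀ hn', mul_comm] at this
  refine (measureReal_mono hsub).trans ((measureReal_union_le _ _).trans ?_)
  linarith

end Bernstein

/-! ### Pairing independent samples. -/

section Independence

variable {Ω : Type*} [MeasurableSpace Ω] {P : Measure Ω}

/-- Two independent samples of independent variables form a sample of independent pairs. -/
theorem iIndepFun_prodMk [IsProbabilityMeasure P] {n : ℕ} {E F : Type*} [MeasurableSpace E]
    [MeasurableSpace F] {X : Fin n → Ω → E} {Y : Fin n → Ω → F} (mX : ∀ i, Measurable (X i))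
    (mY : ∀ i, Measurable (Y i)) (hX : iIndepFun X P) (hY : iIndepFun Y P)
    (hXY : IndepFun (fun ω i => X i ω) (fun ω i => Y i ω) P) :
    iIndepFun (fun i ω => (X i ω, Y i ω)) P := by
  rw [iIndepFun_iff_map_fun_eq_pi_map fun i => ((mX i).prodMk (mY i)).aemeasurable]
  have hpair : ∀ i, P.map (fun ω => (X i ω, Y i ω)) = (P.map (X i)).prod (P.map (Y i)) := by
    intro i
    refine (indepFun_iff_map_prod_eq_prod_map_map (mX i).aemeasurable (mY i).aemeasurable).1 ?_
    exact hXY.comp (measurable_pi_apply i) (measurable_pi_apply i)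
  have hX' := (iIndepFun_iff_map_fun_eq_pi_map fun i => (mX i).aemeasurable).1 hX
  have hY' := (iIndepFun_iff_map_fun_eq_pi_map fun i => (mY i).aemeasurable).1 hY
  have hmX : Measurable (fun ω i => X i ω) := measurable_pi_iff.2 mX
  have hmY : Measurable (fun ω i => Y i ω) := measurable_pi_iff.2 mY
  have hXY' := (indepFun_iff_map_prod_eq_prod_map_map hmX.aemeasurable hmY.aemeasurable).1 hXY
  have : ∀ i, IsProbabilityMeasure (P.map (X i)) := fun i =>
    Measure.isProbabilityMeasure_map (mX i).aemeasurable
  have : ∀ i, IsProbabilityMeasure (P.map (Y i)) := fun i =>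
    Measure.isProbabilityMeasure_map (mY i).aemeasurable
  simp_rw [hpair]
  rw [← (measurePreserving_arrowProdEquivProdArrow E F (Fin n) (fun i => P.map (X i))
    (fun i => P.map (Y i))).symm.map_eq, ← hX', ← hY', ← hXY',
    Measure.map_map (MeasurableEquiv.measurable _) (hmX.prodMk hmY)]
  rfl

end Independence

/-! ### Moments and pointwise concentration in the errors-in-variables model. -/

section Model

variable {Ω : Type*} [MeasurableSpace Ω] {P : Measure Ω} {n p : ℕ}

theorem measurable_dotProduct (v : Fin p → ℝ) : Measurable fun x : Fin p → ℝ => v ⬝ᵥ x := by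
  unfold dotProduct; fun_prop

namespace SubGaussianRows

variable {X : Fin n → Ω → Fin p → ℝ} {C : Matrix (Fin p) (Fin p) ℝ} {σ : ℝ≥0}

theorem hasSubgaussianMGF_dotProduct [IsProbabilityMeasure P] (h : SubGaussianRows P X C σ)
    (i : Fin n) {v : Fin p → ℝ} {r : ℝ≥0} (hv : v ⬝ᵥ v ≤ r) :
    HasSubgaussianMGF (fun ω => v ⬝ᵥ X i ω) (r * σ ^ 2) P := by
  rcases (dotProduct_self_star_nonneg v).eq_or_lt with h0 | h0
  · rw [star_trivial] at h0
    have : v = 0 := dotProduct_self_eq_zero.1 h0.symm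
    subst this
    simp only [zero_dotProduct]
    exact hasSubgaussianMGF_mono HasSubgaussianMGF.fun_zero zero_le
  · rw [star_trivial] at h0
    have hs : 0 < √(v ⬝ᵥ v) := Real.sqrt_pos.2 h0
    have h1 := h.subgaussian i ((√(v ⬝ᵥ v))⁻¹ • v) (by
      rw [smul_dotProduct, dotProduct_smul, smul_eq_mul, smul_eq_mul, ← mul_assoc, ← mul_inv,
        Real.mul_self_sqrt h0.le, inv_mul_cancel₀ h0.ne'])
    have h2 := h1.const_mul (√(v ⬝ᵥ v))
    have h3 : (fun ω => √(v ⬝ᵥ v) * (((√(v ⬝ᵥ v))⁻¹ • v) ⬝ᵥ X i ω)) = fun ω => v ⬝ᵥ X i ω := by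
      ext ω
      rw [smul_dotProduct, smul_eq_mul, ← mul_assoc, mul_inv_cancel₀ hs.ne', one_mul]
    rw [h3] at h2
    refine hasSubgaussianMGF_mono h2 (mul_le_mul_left ?_ _)
    exact NNReal.coe_le_coe.1 (show √(v ⬝ᵥ v) ^ 2 ≤ (r : ℝ) by rwa [Real.sq_sqrt h0.le])

theorem memLp_dotProduct [IsProbabilityMeasure P] (h : SubGaussianRows P X C σ)
    (i : Fin n) (v : Fin p → ℝ) : MemLp (fun ω => v ⬝ᵥ X i ω) 2 P :=
  (h.hasSubgaussianMGF_dotProduct i (r := (v ⬝ᵥ v).toNNReal) (Real.le_coe_toNNReal _)).memLp 2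

theorem memLp_apply [IsProbabilityMeasure P] (h : SubGaussianRows P X C σ)
    (i : Fin n) (j : Fin p) : MemLp (fun ω => X i ω j) 2 P := by
  simpa using h.memLp_dotProduct i (Pi.single j 1)

theorem integral_dotProduct [IsProbabilityMeasure P] (h : SubGaussianRows P X C σ)
    (i : Fin n) (v : Fin p → ℝ) : ∫ ω, v ⬝ᵥ X i ω ∂P = 0 := by
  simp only [dotProduct]
  rw [integral_finsetSum _ fun j _ => ((h.memLp_apply i j).integrable one_le_two).const_mul _]
  simp [integral_const_mul, h.mean_zero]

theorem covariance_dotProduct [IsProbabilityMeasure P] (h : SubGaussianRows P X C σ)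
    (i : Fin n) (u v : Fin p → ℝ) :
    covariance (fun ω => u ⬝ᵥ X i ω) (fun ω => v ⬝ᵥ X i ω) P = u ⬝ᵥ (C *ᵥ v) := by
  simp only [dotProduct]
  rw [covariance_fun_sum_fun_sum (fun j => (h.memLp_apply i j).const_mul _)
    (fun j => (h.memLp_apply i j).const_mul _)]
  simp only [covariance_const_mul_left, covariance_const_mul_right, h.covariance_eq,
    Matrix.mulVec, dotProduct, Finset.mul_sum]
  refine Finset.sum_congr rfl fun j _ => Finset.sum_congr rfl fun l _ => by ring

end SubGaussianRows

namespace ErrorsInVariables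

variable {X W : Fin n → Ω → Fin p → ℝ} {ε : Fin n → Ω → ℝ}
  {covX covW : Matrix (Fin p) (Fin p) ℝ} {σx σw σε : ℝ≥0}

theorem indepFun_dotProduct (h : ErrorsInVariables P X W ε covX covW σx σw σε) (i : Fin n)
    (u v : Fin p → ℝ) : IndepFun (fun ω => u ⬝ᵥ X i ω) (fun ω => v ⬝ᵥ W i ω) P :=
  h.indep_covariates_corruption.comp
    (φ := fun x : Fin n → Fin p → ℝ => u ⬝ᵥ x i) (ψ := fun x : Fin n → Fin p → ℝ => v ⬝ᵥ x i)
    ((measurable_dotProduct u).comp (measurable_pi_apply i))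
    ((measurable_dotProduct v).comp (measurable_pi_apply i))

theorem indepFun_noise (h : ErrorsInVariables P X W ε covX covW σx σw σε) (i : Fin n)
    {g : (Fin p → ℝ) × (Fin p → ℝ) → ℝ} (hg : Measurable g) :
    IndepFun (fun ω => g (X i ω, W i ω)) (ε i) P :=
  h.indep_noise.comp
    (φ := fun x : (Fin n → Fin p → ℝ) × (Fin n → Fin p → ℝ) => g (x.1 i, x.2 i))
    (ψ := fun x : Fin n → ℝ => x i)
    (by fun_prop) (measurable_pi_apply i)

theorem iIndepFun_samples [IsProbabilityMeasure P]
    (h : ErrorsInVariables P X W ε covX covW σx σw σε) :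
    iIndepFun (fun i ω => ((X i ω, W i ω), ε i ω)) P := by
  have h1 := iIndepFun_prodMk h.covariates.measurable h.corruption.measurable h.covariates.indep
    h.corruption.indep h.indep_covariates_corruption
  refine iIndepFun_prodMk (fun i => (h.covariates.measurable i).prodMk (h.corruption.measurable i))
    h.noise_measurable h1 h.noise_indep ?_
  exact h.indep_noise.comp
    (φ := fun x : (Fin n → Fin p → ℝ) × (Fin n → Fin p → ℝ) => fun i => (x.1 i, x.2 i))
    (ψ := id) (by fun_prop) measurable_id

theorem hasSubgaussianMGF_observed [IsProbabilityMeasure P]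
    (h : ErrorsInVariables P X W ε covX covW σx σw σε) (i : Fin n) {u : Fin p → ℝ} {r : ℝ≥0}
    (hu : u ⬝ᵥ u ≤ r) {c : ℝ≥0} (hc : r * σx ^ 2 + r * σw ^ 2 ≤ c) :
    HasSubgaussianMGF (fun ω => u ⬝ᵥ X i ω + u ⬝ᵥ W i ω) c P :=
  hasSubgaussianMGF_mono ((h.covariates.hasSubgaussianMGF_dotProduct i hu).add_of_indepFun
    (h.corruption.hasSubgaussianMGF_dotProduct i hu) (h.indepFun_dotProduct i u u)) hc

theorem hasSubgaussianMGF_residual [IsProbabilityMeasure P]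
    (h : ErrorsInVariables P X W ε covX covW σx σw σε) (i : Fin n) {u : Fin p → ℝ} {r : ℝ≥0}
    (hu : u ⬝ᵥ u ≤ r) {c : ℝ≥0} (hc : σε ^ 2 + r * σw ^ 2 ≤ c) :
    HasSubgaussianMGF (fun ω => ε i ω - u ⬝ᵥ W i ω) c P :=
  hasSubgaussianMGF_mono ((h.noise_subgaussian i).sub_of_indepFun
    (h.corruption.hasSubgaussianMGF_dotProduct i hu)
    (h.indepFun_noise i ((measurable_dotProduct u).comp measurable_snd)).symm) hc

theorem memLp_observed [IsProbabilityMeasure P]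
    (h : ErrorsInVariables P X W ε covX covW σx σw σε) (i : Fin n) (u : Fin p → ℝ) :
    MemLp (fun ω => u ⬝ᵥ X i ω + u ⬝ᵥ W i ω) 2 P :=
  (h.covariates.memLp_dotProduct i u).add (h.corruption.memLp_dotProduct i u)

theorem integral_observed [IsProbabilityMeasure P]
    (h : ErrorsInVariables P X W ε covX covW σx σw σε) (i : Fin n) (u : Fin p → ℝ) :
    ∫ ω, (u ⬝ᵥ X i ω + u ⬝ᵥ W i ω) ∂P = 0 := by
  rw [integral_add ((h.covariates.memLp_dotProduct i u).integrable one_le_two)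
    ((h.corruption.memLp_dotProduct i u).integrable one_le_two),
    h.covariates.integral_dotProduct, h.corruption.integral_dotProduct, add_zero]

theorem integral_observed_mul_observed [IsProbabilityMeasure P]
    (h : ErrorsInVariables P X W ε covX covW σx σw σε) (i : Fin n) (u v : Fin p → ℝ) :
    ∫ ω, (u ⬝ᵥ X i ω + u ⬝ᵥ W i ω) * (v ⬝ᵥ X i ω + v ⬝ᵥ W i ω) ∂P
      = u ⬝ᵥ ((covX + covW) *ᵥ v) := by
  have hc := covariance_eq_sub (h.memLp_observed i u) (h.memLp_observed i v)
  rw [h.integral_observed, zero_mul, sub_zero] at hc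
  have e1 : (fun ω => u ⬝ᵥ X i ω + u ⬝ᵥ W i ω)
    = (fun ω => u ⬝ᵥ X i ω) + fun ω => u ⬝ᵥ W i ω := rfl
  have e2 : (fun ω => v ⬝ᵥ X i ω + v ⬝ᵥ W i ω)
    = (fun ω => v ⬝ᵥ X i ω) + fun ω => v ⬝ᵥ W i ω := rfl
  have mX := fun u => h.covariates.memLp_dotProduct i u
  have mW := fun u => h.corruption.memLp_dotProduct i u
  calc _ = covariance (fun ω => u ⬝ᵥ X i ω + u ⬝ᵥ W i ω)
        (fun ω => v ⬝ᵥ X i ω + v ⬝ᵥ W i ω) P := hc.symm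
    _ = _ := by
      rw [e1, e2, covariance_add_left (mX u) (mW u) ((mX v).add (mW v)),
        covariance_add_right (mX u) (mX v) (mW v), covariance_add_right (mW u) (mX v) (mW v),
        (h.indepFun_dotProduct i u v).covariance_eq_zero (mX u) (mW v),
        (h.indepFun_dotProduct i v u).symm.covariance_eq_zero (mW u) (mX v),
        h.covariates.covariance_dotProduct, h.corruption.covariance_dotProduct, Matrix.add_mulVec,
        dotProduct_add]
      ring

/-- Since `y - Zβ* = ε - Wβ*`, this is the mean of the linear forms of `Zᵀ(y - Zβ*) / n` when `v =
β*`. It is nonzero because `w` occurs in both factors, and it is cancelled by the correction `Σ_w`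
in `Γ̂`; hence `γ̂ - Γ̂β*` is centred. -/
theorem integral_observed_mul_residual [IsProbabilityMeasure P]
    (h : ErrorsInVariables P X W ε covX covW σx σw σε) (i : Fin n) (u v : Fin p → ℝ) :
    ∫ ω, (u ⬝ᵥ X i ω + u ⬝ᵥ W i ω) * (ε i ω - v ⬝ᵥ W i ω) ∂P = -(u ⬝ᵥ (covW *ᵥ v)) := by
  have mX := fun u => h.covariates.memLp_dotProduct i u
  have mW := fun u => h.corruption.memLp_dotProduct i u
  have mε : MemLp (ε i) 2 P := (h.noise_subgaussian i).memLp 2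
  have hc := covariance_eq_sub (h.memLp_observed i u) (mε.sub (mW v))
  rw [h.integral_observed, zero_mul, sub_zero] at hc
  have e1 : (fun ω => u ⬝ᵥ X i ω + u ⬝ᵥ W i ω)
    = (fun ω => u ⬝ᵥ X i ω) + fun ω => u ⬝ᵥ W i ω := rfl
  have hind : IndepFun (fun ω => u ⬝ᵥ X i ω + u ⬝ᵥ W i ω) (ε i) P :=
    h.indepFun_noise i (g := fun x => u ⬝ᵥ x.1 + u ⬝ᵥ x.2)
      (((measurable_dotProduct u).comp measurable_fst).add
        ((measurable_dotProduct u).comp measurable_snd))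
  calc _ = covariance (fun ω => u ⬝ᵥ X i ω + u ⬝ᵥ W i ω)
        (ε i - fun ω => v ⬝ᵥ W i ω) P := hc.symm
    _ = _ := by
      rw [covariance_sub_right (h.memLp_observed i u) mε (mW v),
        hind.covariance_eq_zero (h.memLp_observed i u) mε, e1,
        covariance_add_left (mX u) (mW u) (mW v),
        (h.indepFun_dotProduct i u v).covariance_eq_zero (mX u) (mW v),
        h.corruption.covariance_dotProduct]
      ring

theorem isHermitian_covX (h : ErrorsInVariables P X W ε covX covW σx σw σε) (hn : 0 < n) :
    covX.IsHermitian := by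
  ext j l
  simp only [Matrix.conjTranspose_apply, star_trivial]
  rw [← h.covariates.covariance_eq ⟨0, hn⟩, ← h.covariates.covariance_eq ⟨0, hn⟩, covariance_comm]

theorem isHermitian_covW (h : ErrorsInVariables P X W ε covX covW σx σw σε) (hn : 0 < n) :
    covW.IsHermitian := by
  ext j l
  simp only [Matrix.conjTranspose_apply, star_trivial]
  rw [← h.corruption.covariance_eq ⟨0, hn⟩, ← h.corruption.covariance_eq ⟨0, hn⟩, covariance_comm]

end ErrorsInVariables

theorem dotProduct_gammaMat_mulVec (Z : Matrix (Fin n) (Fin p) ℝ)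
    (C : Matrix (Fin p) (Fin p) ℝ) (u v : Fin p → ℝ) :
    u ⬝ᵥ (gammaMat Z C *ᵥ v) = (n : ℝ)⁻¹ * ((Z *ᵥ u) ⬝ᵥ (Z *ᵥ v)) - u ⬝ᵥ (C *ᵥ v) := by
  rw [gammaMat, Matrix.sub_mulVec, dotProduct_sub, Matrix.smul_mulVec, dotProduct_smul,
    smul_eq_mul, ← Matrix.mulVec_mulVec, Matrix.dotProduct_mulVec, Matrix.vecMul_transpose]

theorem dotProduct_gammaVec (Z : Matrix (Fin n) (Fin p) ℝ) (y : Fin n → ℝ) (u : Fin p → ℝ) :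
    u ⬝ᵥ gammaVec Z y = (n : ℝ)⁻¹ * ((Z *ᵥ u) ⬝ᵥ y) := by
  rw [gammaVec, dotProduct_smul, smul_eq_mul, Matrix.dotProduct_mulVec, Matrix.vecMul_transpose]

theorem observedDesign_mulVec {Ω' : Type*} (X W : Fin n → Ω' → Fin p → ℝ) (ω : Ω') (u : Fin p → ℝ) (i : Fin n) :
    (observedDesign X W ω *ᵥ u) i = u ⬝ᵥ X i ω + u ⬝ᵥ W i ω := by
  rw [← dotProduct_add, dotProduct_comm]
  rfl

namespace ErrorsInVariables

variable {X W : Fin n → Ω → Fin p → ℝ} {ε : Fin n → Ω → ℝ}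
  {covX covW : Matrix (Fin p) (Fin p) ℝ} {σx σw σε : ℝ≥0}

theorem measurable_observed (h : ErrorsInVariables P X W ε covX covW σx σw σε) (i : Fin n)
    (u : Fin p → ℝ) : Measurable fun ω => u ⬝ᵥ X i ω + u ⬝ᵥ W i ω :=
  ((measurable_dotProduct u).comp (h.covariates.measurable i)).add
    ((measurable_dotProduct u).comp (h.corruption.measurable i))

/-- Concentration of the bilinear form of the corrected Gram matrix. -/
theorem measure_gammaMat_deviation_le [IsProbabilityMeasure P]
    (h : ErrorsInVariables P X W ε covX covW σx σw σε) (hn : 0 < n) {u v : Fin p → ℝ} {r : ℝ≥0}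
    (hu : u ⬝ᵥ u ≤ r) (hv : v ⬝ᵥ v ≤ r) {c : ℝ≥0} (hc0 : 0 < c)
    (hc : r * σx ^ 2 + r * σw ^ 2 ≤ c) {t : ℝ} (ht0 : 0 ≤ t) (ht1 : t ≤ 1) :
    P.real {ω | productScale c * t <
      |u ⬝ᵥ ((gammaMat (observedDesign X W ω) covW - covX) *ᵥ v)|} ≤ 2 * Real.exp (-(n * t ^ 2)) := by
  have hind : iIndepFun (fun i ω => (u ⬝ᵥ X i ω + u ⬝ᵥ W i ω) * (v ⬝ᵥ X i ω + v ⬝ᵥ W i ω)) P :=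
    h.iIndepFun_samples.comp
      (fun _ x => (u ⬝ᵥ x.1.1 + u ⬝ᵥ x.1.2) * (v ⬝ᵥ x.1.1 + v ⬝ᵥ x.1.2)) fun _ => by
        have := measurable_dotProduct u
        have := measurable_dotProduct v
        fun_prop
  have := measure_mean_mul_deviation_le hn (fun i => h.measurable_observed i u)
    (fun i => h.measurable_observed i v) hc0 (fun i => h.hasSubgaussianMGF_observed i hu hc)
    (fun i => h.hasSubgaussianMGF_observed i hv hc) hind
    (fun i => h.integral_observed_mul_observed i u v) ht0 ht1
  convert this using 6 with ω
  rw [Matrix.sub_mulVec, dotProduct_sub, dotProduct_gammaMat_mulVec, dotProduct,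
    Matrix.add_mulVec, dotProduct_add]
  simp only [observedDesign_mulVec]
  ring

/-- Concentration of the linear forms of `γ̂ - Γ̂ β*`. -/
theorem measure_gammaVec_deviation_le [IsProbabilityMeasure P]
    (h : ErrorsInVariables P X W ε covX covW σx σw σε) (hn : 0 < n) {u v : Fin p → ℝ} {r : ℝ≥0}
    (hu : u ⬝ᵥ u ≤ r) (hv : v ⬝ᵥ v ≤ r) {c : ℝ≥0} (hc0 : 0 < c)
    (hc : r * σx ^ 2 + r * σw ^ 2 ≤ c) (hc' : σε ^ 2 + r * σw ^ 2 ≤ c)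
    {t : ℝ} (ht0 : 0 ≤ t) (ht1 : t ≤ 1) :
    P.real {ω | productScale c * t <
      |u ⬝ᵥ (gammaVec (observedDesign X W ω) (response X ε v ω)
        - gammaMat (observedDesign X W ω) covW *ᵥ v)|} ≤ 2 * Real.exp (-(n * t ^ 2)) := by
  have hind : iIndepFun (fun i ω => (u ⬝ᵥ X i ω + u ⬝ᵥ W i ω) * (ε i ω - v ⬝ᵥ W i ω)) P :=
    h.iIndepFun_samples.comp
      (fun _ x => (u ⬝ᵥ x.1.1 + u ⬝ᵥ x.1.2) * (x.2 - v ⬝ᵥ x.1.2)) fun _ => by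
        have := measurable_dotProduct u
        have := measurable_dotProduct v
        fun_prop
  have := measure_mean_mul_deviation_le hn (A := fun i ω => u ⬝ᵥ X i ω + u ⬝ᵥ W i ω)
    (B := fun i ω => ε i ω - v ⬝ᵥ W i ω) (fun i => h.measurable_observed i u)
    (fun i => (h.noise_measurable i).sub
      ((measurable_dotProduct v).comp (h.corruption.measurable i))) hc0
    (fun i => h.hasSubgaussianMGF_observed i hu hc)
    (fun i => h.hasSubgaussianMGF_residual i hv hc') hind
    (fun i => h.integral_observed_mul_residual i u v) ht0 ht1
  convert this using 6 with ω
  rw [dotProduct_sub, dotProduct_gammaMat_mulVec, dotProduct_gammaVec]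
  have : ∀ i, (u ⬝ᵥ X i ω + u ⬝ᵥ W i ω) * (ε i ω - v ⬝ᵥ W i ω)
      = (observedDesign X W ω *ᵥ u) i * response X ε v ω i
        - (observedDesign X W ω *ᵥ u) i * (observedDesign X W ω *ᵥ v) i := by
    intro i
    rw [observedDesign_mulVec, observedDesign_mulVec, response, dotProduct_comm (X i ω)]
    ring
  simp only [this, Finset.sum_sub_distrib]
  simp only [dotProduct]
  ring

end ErrorsInVariables

end Model

/-! ### A lattice net for sparse vectors. -/

section Net

variable {p : ℕ}

/-- Integer vectors supported in `T` with squared Euclidean norm at most `4 s`. -/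
noncomputable def latticeBall (T : Finset (Fin p)) (s : ℕ) : Finset (Fin p → ℤ) :=
  (Fintype.piFinset fun j => if j ∈ T then Finset.Icc (-(4 * s : ℤ)) (4 * s) else {0}).filter
    fun z => ∑ j, z j ^ 2 ≤ 4 * s

/-- Integers satisfy `|m| ≤ m²`, so the norm constraint already implies the box constraint. The box
only provides finiteness and a product structure. -/
theorem mem_latticeBall {T : Finset (Fin p)} {s : ℕ} {z : Fin p → ℤ} :
    z ∈ latticeBall T s ↔ (∀ j ∉ T, z j = 0) ∧ ∑ j, z j ^ 2 ≤ 4 * s := by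
  simp only [latticeBall, Finset.mem_filter, Fintype.mem_piFinset]
  refine and_congr_left fun hz => ⟨fun h j hj => by simpa [hj] using h j, fun h j => ?_⟩
  split_ifs with hj
  · have h1 : z j ^ 2 ≤ ∑ j, z j ^ 2 :=
      Finset.single_le_sum (f := fun j => z j ^ 2) (fun i _ => sq_nonneg (z i)) (Finset.mem_univ j)
    rw [Finset.mem_Icc]
    constructor
    · nlinarith [Int.le_self_sq (-z j)]
    · nlinarith [Int.le_self_sq (z j)]
  · simpa using h j hj

theorem sum_Icc_pow_natAbs_le {q : ℝ} (hq0 : 0 < q) (hq : q ≤ 1 / 2) (B : ℕ) :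
    ∑ m ∈ Finset.Icc (-(B : ℤ)) B, q ^ m.natAbs ≤ 1 + 4 * q := by
  have key : ∀ B : ℕ, (∑ m ∈ Finset.Icc (-(B : ℤ)) B, q ^ m.natAbs) * (1 - q)
      = 1 + q - 2 * q ^ (B + 1) := by
    intro B
    induction B with
    | zero => simp; ring
    | succ B ih =>
      have h : Finset.Icc (-((B + 1 : ℕ) : ℤ)) ((B + 1 : ℕ) : ℤ)
          = insert (-((B + 1 : ℕ) : ℤ)) (insert ((B + 1 : ℕ) : ℤ) (Finset.Icc (-(B : ℤ)) B)) := by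
        ext m; simp only [Finset.mem_Icc, Finset.mem_insert]; push_cast; omega
      rw [h, Finset.sum_insert, Finset.sum_insert, Int.natAbs_neg, Int.natAbs_natCast, add_mul,
        add_mul, ih]
      · ring
      · simp only [Finset.mem_Icc]; push_cast; omega
      · simp only [Finset.mem_Icc, Finset.mem_insert]; push_cast; omega
  have h1 := key B
  have h2 : 0 < q ^ (B + 1) := by positivity
  nlinarith

/-- Generating-function count: `∑ |z j| ≤ ∑ z j ² ≤ 4s`, so each lattice point has weight at least
one in `q^(-4s) ∏ q^|z j|`, and over the box this weight factorizes. The free parameter serves two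
regimes: `q = 1/2` for a small `T`, and `q = 1/p` for all coordinates, where no separate union over
supports is required. -/
theorem card_latticeBall_le (T : Finset (Fin p)) (s : ℕ) {q : ℝ} (hq0 : 0 < q) (hq : q ≤ 1 / 2) :
    ((latticeBall T s).card : ℝ) ≤ (q⁻¹) ^ (4 * s) * (1 + 4 * q) ^ T.card := by
  have hq1 : q ≤ 1 := by linarith
  have h1 : ∀ z ∈ latticeBall T s, (1 : ℝ) ≤ (q⁻¹) ^ (4 * s) * ∏ j, q ^ (z j).natAbs := by
    intro z hz
    rw [mem_latticeBall] at hz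
    have h2 : ∑ j, (z j).natAbs ≤ 4 * s := by
      have : ((∑ j, (z j).natAbs : ℕ) : ℤ) ≤ ∑ j, z j ^ 2 := by
        push_cast
        refine Finset.sum_le_sum fun j _ => ?_
        rw [← sq_abs]
        exact Int.le_self_sq _
      have := this.trans hz.2
      exact_mod_cast this
    rw [Finset.prod_pow_eq_pow_sum, inv_pow, inv_mul_eq_div, one_le_div (by positivity)]
    exact pow_le_pow_of_le_one hq0.le hq1 h2
  calc ((latticeBall T s).card : ℝ) = ∑ z ∈ latticeBall T s, (1 : ℝ) := by simp
    _ ≤ ∑ z ∈ latticeBall T s, (q⁻¹) ^ (4 * s) * ∏ j, q ^ (z j).natAbs := Finset.sum_le_sum h1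
    _ = (q⁻¹) ^ (4 * s) * ∑ z ∈ latticeBall T s, ∏ j, q ^ (z j).natAbs := by rw [Finset.mul_sum]
    _ ≤ (q⁻¹) ^ (4 * s) * ∑ z ∈ Fintype.piFinset fun j =>
          if j ∈ T then Finset.Icc (-(4 * s : ℤ)) (4 * s) else {0}, ∏ j, q ^ (z j).natAbs := by
        gcongr
        exact Finset.filter_subset _ _
    _ = (q⁻¹) ^ (4 * s) * ∏ j, ∑ m ∈ (if j ∈ T then Finset.Icc (-(4 * s : ℤ)) (4 * s) else {0}),
          q ^ m.natAbs := by
        rw [Finset.prod_univ_sum (f := fun (_ : Fin p) (m : ℤ) => q ^ m.natAbs)]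
    _ ≤ (q⁻¹) ^ (4 * s) * ∏ j, (if j ∈ T then 1 + 4 * q else 1) := by
        gcongr with j
        split_ifs
        · exact_mod_cast sum_Icc_pow_natAbs_le hq0 hq (4 * s)
        · simp
    _ = _ := by rw [Finset.prod_ite_mem]; simp

/-- A vector of the unit ball with at most `s` nonzero coordinates is dominated, along any given
direction, by a rescaled lattice vector with the same support. -/
theorem exists_mem_latticeBall_le {T T' : Finset (Fin p)} (hT : T' ⊆ T) {s : ℕ} (hs : 0 < s)
    (hT' : T'.card ≤ s) {x : Fin p → ℝ} (hx : ∀ j ∉ T', x j = 0) (hx1 : x ⬝ᵥ x ≤ 1)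
    (g : Fin p → ℝ) :
    ∃ z ∈ latticeBall T s, x ⬝ᵥ g ≤ ((√s)⁻¹ • fun j => (z j : ℝ)) ⬝ᵥ g := by
  have hs' : (0 : ℝ) < s := by exact_mod_cast hs
  have hr : 0 < √(s : ℝ) := Real.sqrt_pos.2 hs'
  have hz : ∀ j, ∃ m : ℤ, (j ∉ T' → m = 0) ∧ √s * x j * g j ≤ m * g j ∧
      (m : ℝ) ^ 2 ≤ 2 * (√s * x j) ^ 2 + if j ∈ T' then 2 else 0 := by
    intro j
    by_cases hj : j ∈ T'
    · rcases le_total 0 (g j) with hg | hg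
      · refine ⟨⌈√s * x j⌉, fun h => (h hj).elim, ?_, ?_⟩
        · exact mul_le_mul_of_nonneg_right (Int.le_ceil _) hg
        · rw [if_pos hj]
          have h1 := Int.le_ceil (√s * x j)
          have h2 := Int.ceil_lt_add_one (√s * x j)
          nlinarith [sq_nonneg ((⌈√s * x j⌉ : ℝ) - 2 * (√s * x j))]
      · refine ⟨⌊√s * x j⌋, fun h => (h hj).elim, ?_, ?_⟩
        · exact mul_le_mul_of_nonpos_right (Int.floor_le _) hg
        · rw [if_pos hj]
          have h1 := Int.floor_le (√s * x j)
          have h2 := Int.lt_floor_add_one (√s * x j)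
          nlinarith [sq_nonneg ((⌊√s * x j⌋ : ℝ) - 2 * (√s * x j))]
    · exact ⟨0, fun _ => rfl, by simp [hx j hj], by simp [hx j hj, hj]⟩
  choose z hz0 hz1 hz2 using hz
  refine ⟨z, mem_latticeBall.2 ⟨fun j hj => hz0 j fun h => hj (hT h), ?_⟩, ?_⟩
  · have h1 : ∑ j, (z j : ℝ) ^ 2 ≤ 4 * s := by
      calc ∑ j, (z j : ℝ) ^ 2 ≤ ∑ j, (2 * (√s * x j) ^ 2 + if j ∈ T' then 2 else 0) :=
            Finset.sum_le_sum fun j _ => hz2 j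
        _ = 2 * s * (x ⬝ᵥ x) + 2 * T'.card := by
            rw [Finset.sum_add_distrib, dotProduct, Finset.mul_sum]
            congr 1
            · refine Finset.sum_congr rfl fun j _ => ?_
              rw [mul_pow, Real.sq_sqrt hs'.le]; ring
            · simp [mul_comm]
        _ ≤ 2 * s * 1 + 2 * s := by gcongr
        _ = 4 * s := by ring
    exact_mod_cast h1
  · rw [smul_dotProduct, smul_eq_mul, inv_mul_eq_div, le_div_iff₀ hr, mul_comm]
    simp only [dotProduct, Finset.mul_sum]
    exact Finset.sum_le_sum fun j _ => by simpa [mul_assoc] using hz1 j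

theorem dotProduct_self_latticeBall_le {T : Finset (Fin p)} {s : ℕ} (hs : 0 < s) {z : Fin p → ℤ}
    (hz : z ∈ latticeBall T s) :
    ((√s)⁻¹ • fun j => (z j : ℝ)) ⬝ᵥ ((√s)⁻¹ • fun j => (z j : ℝ)) ≤ (4 : ℝ≥0) := by
  have hs' : (0 : ℝ) < s := by exact_mod_cast hs
  have h : ∑ j, (z j : ℝ) ^ 2 ≤ 4 * s := by exact_mod_cast (mem_latticeBall.1 hz).2
  rw [smul_dotProduct, dotProduct_smul, smul_eq_mul, smul_eq_mul, ← mul_assoc, ← mul_inv,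
    Real.mul_self_sqrt hs'.le, inv_mul_eq_div, div_le_iff₀ hs']
  simpa [dotProduct, sq] using h

/-- The rounding lemma is applied to `x` against `D y`, then to `y` against the row vector produced
by the first lattice point. Domination is exact, so `δ` passes from the net to all sparse vectors
without loss. -/
theorem bilin_le_of_forall_latticeBall {T T' : Finset (Fin p)} (hT : T' ⊆ T) {s : ℕ} (hs : 0 < s)
    (hT' : T'.card ≤ s) {D : Matrix (Fin p) (Fin p) ℝ} {δ : ℝ}
    (hD : ∀ z ∈ latticeBall T s, ∀ z' ∈ latticeBall T s,
      |((√s)⁻¹ • fun j => (z j : ℝ)) ⬝ᵥ (D *ᵥ ((√s)⁻¹ • fun j => (z' j : ℝ)))| ≤ δ)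
    {x y : Fin p → ℝ} (hx : ∀ j ∉ T', x j = 0) (hy : ∀ j ∉ T', y j = 0) :
    |x ⬝ᵥ (D *ᵥ y)| ≤ δ * (√(x ⬝ᵥ x) * √(y ⬝ᵥ y)) := by
  have unit : ∀ x y : Fin p → ℝ, (∀ j ∉ T', x j = 0) → (∀ j ∉ T', y j = 0) → x ⬝ᵥ x ≤ 1 →
      y ⬝ᵥ y ≤ 1 → x ⬝ᵥ (D *ᵥ y) ≤ δ := by
    intro x y hx hy hx1 hy1
    obtain ⟨z, hz, h1⟩ := exists_mem_latticeBall_le hT hs hT' hx hx1 (D *ᵥ y)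
    obtain ⟨z', hz', h2⟩ := exists_mem_latticeBall_le hT hs hT' hy hy1
      (Matrix.vecMul ((√s)⁻¹ • fun j => (z j : ℝ)) D)
    rw [dotProduct_comm y, ← Matrix.dotProduct_mulVec, dotProduct_comm _ (Matrix.vecMul _ _),
      ← Matrix.dotProduct_mulVec] at h2
    exact h1.trans (h2.trans ((le_abs_self _).trans (hD z hz z' hz')))
  have nonneg : ∀ v : Fin p → ℝ, 0 ≤ v ⬝ᵥ v := fun v => by
    simpa using dotProduct_self_star_nonneg v
  have scaled : ∀ x y : Fin p → ℝ, (∀ j ∉ T', x j = 0) → (∀ j ∉ T', y j = 0) →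
      x ⬝ᵥ (D *ᵥ y) ≤ δ * (√(x ⬝ᵥ x) * √(y ⬝ᵥ y)) := by
    intro x y hx hy
    rcases (nonneg x).eq_or_lt with h | hx0
    · rw [dotProduct_self_eq_zero.1 h.symm]; simp
    rcases (nonneg y).eq_or_lt with h | hy0
    · rw [dotProduct_self_eq_zero.1 h.symm]; simp
    have hx' := Real.sqrt_pos.2 hx0
    have hy' := Real.sqrt_pos.2 hy0
    have norm : ∀ v : Fin p → ℝ, 0 < v ⬝ᵥ v →
        ((√(v ⬝ᵥ v))⁻¹ • v) ⬝ᵥ ((√(v ⬝ᵥ v))⁻¹ • v) ≤ 1 := by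
      intro v hv
      rw [smul_dotProduct, dotProduct_smul, smul_eq_mul, smul_eq_mul, ← mul_assoc, ← mul_inv,
        Real.mul_self_sqrt hv.le, inv_mul_cancel₀ hv.ne']
    have h := unit ((√(x ⬝ᵥ x))⁻¹ • x) ((√(y ⬝ᵥ y))⁻¹ • y) (fun j hj => by simp [hx j hj])
      (fun j hj => by simp [hy j hj]) (norm x hx0) (norm y hy0)
    rw [smul_dotProduct, Matrix.mulVec_smul, dotProduct_smul, smul_eq_mul, smul_eq_mul,
      ← mul_assoc, ← mul_inv, inv_mul_eq_div, div_le_iff₀ (by positivity)] at h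
    exact h
  refine abs_le'.2 ⟨scaled x y hx hy, ?_⟩
  have := scaled (-x) y (fun j hj => by simp [hx j hj]) hy
  simpa [neg_dotProduct] using this

end Net

/-! ### Uniform concentration over sparse vectors. -/

section NetModel

variable {Ω : Type*} [MeasurableSpace Ω] {P : Measure Ω} {n p : ℕ}
  {X W : Fin n → Ω → Fin p → ℝ} {ε : Fin n → Ω → ℝ}
  {covX covW : Matrix (Fin p) (Fin p) ℝ} {σx σw σε : ℝ≥0}

/-- Uniform concentration of the corrected Gram matrix over sparse vectors. -/
theorem ErrorsInVariables.measure_sparse_deviation_le [IsProbabilityMeasure P]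
    (h : ErrorsInVariables P X W ε covX covW σx σw σε) (hn : 0 < n) (T : Finset (Fin p)) {s : ℕ}
    (hs : 0 < s) {c : ℝ≥0} (hc0 : 0 < c) (hc : 4 * σx ^ 2 + 4 * σw ^ 2 ≤ c) {t : ℝ} (ht0 : 0 ≤ t)
    (ht1 : t ≤ 1) {q : ℝ} (hq0 : 0 < q) (hq : q ≤ 1 / 2) :
    P.real {ω | ¬ ∀ T' ⊆ T, T'.card ≤ s → ∀ x y : Fin p → ℝ, (∀ j ∉ T', x j = 0) →
      (∀ j ∉ T', y j = 0) →
      |x ⬝ᵥ ((gammaMat (observedDesign X W ω) covW - covX) *ᵥ y)|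
        ≤ productScale c * t * (√(x ⬝ᵥ x) * √(y ⬝ᵥ y))}
      ≤ ((q⁻¹) ^ (4 * s) * (1 + 4 * q) ^ T.card) ^ 2 * (2 * Real.exp (-(n * t ^ 2))) := by
  set bad : (Fin p → ℤ) × (Fin p → ℤ) → Set Ω := fun z =>
    {ω | productScale c * t < |((√s)⁻¹ • fun j => (z.1 j : ℝ)) ⬝ᵥ
      ((gammaMat (observedDesign X W ω) covW - covX) *ᵥ ((√s)⁻¹ • fun j => (z.2 j : ℝ)))|}
  have hsub : {ω | ¬ ∀ T' ⊆ T, T'.card ≤ s → ∀ x y : Fin p → ℝ, (∀ j ∉ T', x j = 0) →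
      (∀ j ∉ T', y j = 0) →
      |x ⬝ᵥ ((gammaMat (observedDesign X W ω) covW - covX) *ᵥ y)|
        ≤ productScale c * t * (√(x ⬝ᵥ x) * √(y ⬝ᵥ y))}
      ⊆ ⋃ z ∈ latticeBall T s ×ˢ latticeBall T s, bad z := by
    intro ω hω
    by_contra hcon
    refine hω fun T' hT hT' x y hx hy => ?_
    refine bilin_le_of_forall_latticeBall hT hs hT' (fun z hz z' hz' => ?_) hx hy
    by_contra hlt
    refine hcon (Set.mem_biUnion (x := (z, z')) ?_ (not_le.1 hlt))
    exact Finset.mem_coe.2 (Finset.mem_product.2 ⟨hz, hz'⟩)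
  refine (measureReal_mono hsub (measure_ne_top _ _)).trans ((measureReal_biUnion_finset_le _ _).trans ?_)
  calc ∑ z ∈ latticeBall T s ×ˢ latticeBall T s, P.real (bad z)
      ≤ ∑ _z ∈ latticeBall T s ×ˢ latticeBall T s, 2 * Real.exp (-(n * t ^ 2)) := by
        refine Finset.sum_le_sum fun z hz => ?_
        rw [Finset.mem_product] at hz
        exact h.measure_gammaMat_deviation_le hn (dotProduct_self_latticeBall_le hs hz.1)
          (dotProduct_self_latticeBall_le hs hz.2) hc0 hc ht0 ht1
    _ = ((latticeBall T s).card : ℝ) ^ 2 * (2 * Real.exp (-(n * t ^ 2))) := by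
        rw [Finset.sum_const, Finset.card_product, nsmul_eq_mul]; push_cast; ring
    _ ≤ _ := by
        gcongr
        exact card_latticeBall_le T s hq0 hq

end NetModel

/-! ### From sparse to arbitrary vectors. -/

section SparseToDense

variable {p : ℕ}

theorem l1Norm_nonneg (v : Fin p → ℝ) : 0 ≤ l1Norm v := Finset.sum_nonneg fun _ _ => abs_nonneg _

theorem dotProduct_self_nonneg' (v : Fin p → ℝ) : 0 ≤ v ⬝ᵥ v := by
  simpa using dotProduct_self_star_nonneg v

/-- One step of the greedy sparsification of `v`. -/
theorem exists_single_quadForm_le (M : Matrix (Fin p) (Fin p) ℝ) {d : ℝ} (hd : ∀ j, M j j ≤ d)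
    {v : Fin p → ℝ} (hv : v ≠ 0) (g : Fin p → ℝ) :
    ∃ (j : Fin p) (a : ℝ), Pi.single j a ⬝ᵥ (M *ᵥ Pi.single j a) + Pi.single j a ⬝ᵥ g
      ≤ l1Norm v ^ 2 * d + v ⬝ᵥ g := by
  set N := l1Norm v with hN
  set σ : Fin p → ℝ := fun j => if 0 ≤ v j then 1 else -1 with hσ
  have hσ2 : ∀ j, σ j * σ j = 1 := fun j => by simp only [hσ]; split_ifs <;> norm_num
  have hσv : ∀ j, |v j| * σ j = v j := fun j => by
    simp only [hσ]
    split_ifs with h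
    · rw [abs_of_nonneg h, mul_one]
    · rw [abs_of_neg (not_le.1 h)]; ring
  -- With `N = ‖v‖₁`, `v` is the mean of the vectors `N σ j e j` under the weights `|v j| / N`. If
  -- every one of them exceeded the bound, so would their weighted average.
  by_contra! hcon
  obtain ⟨i, hi⟩ : ∃ i, v i ≠ 0 := by
    by_contra! h
    exact hv (funext h)
  have h1 : ∀ j, N ^ 2 * d + v ⬝ᵥ g < N ^ 2 * M j j + N * σ j * g j := by
    intro j
    have := hcon j (N * σ j)
    rw [single_dotProduct, single_dotProduct, Matrix.mulVec_single] at this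
    simp only [Matrix.col_apply, MulOpposite.smul_eq_mul_unop, MulOpposite.unop_op, Pi.smul_apply]
      at this
    have e : N * σ j * (M j j * (N * σ j)) = N ^ 2 * M j j * (σ j * σ j) := by ring
    rwa [e, hσ2, mul_one] at this
  have h2 : ∑ j, |v j| * (N ^ 2 * d + v ⬝ᵥ g) < ∑ j, |v j| * (N ^ 2 * M j j + N * σ j * g j) := by
    refine Finset.sum_lt_sum (fun j _ => mul_le_mul_of_nonneg_left (h1 j).le (abs_nonneg _))
      ⟨i, Finset.mem_univ i, mul_lt_mul_of_pos_left (h1 i) (abs_pos.2 hi)⟩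
  have h3 : ∑ j, |v j| * (N ^ 2 * M j j + N * σ j * g j) ≤ ∑ j, (|v j| * (N ^ 2 * d) +
      N * (v j * g j)) := by
    refine Finset.sum_le_sum fun j _ => ?_
    have e : |v j| * (N ^ 2 * M j j + N * σ j * g j)
        = |v j| * (N ^ 2 * M j j) + N * (|v j| * σ j * g j) := by ring
    rw [e, hσv]
    have := hd j
    gcongr
  rw [← Finset.sum_mul] at h2
  rw [Finset.sum_add_distrib, ← Finset.sum_mul, ← Finset.mul_sum] at h3
  change N * _ < _ at h2
  change _ ≤ N * _ + N * (v ⬝ᵥ g) at h3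
  linarith

/-- Maurey's empirical method without randomness. For a sum of `m` independent copies of a random
one-sparse vector with mean `v`, the right-hand side bounds the expected quadratic form at `u` plus
that sum; the coordinates are picked one at a time so as not to exceed it. -/
theorem exists_sparse_quadForm_le (M : Matrix (Fin p) (Fin p) ℝ) {d : ℝ} (hd : ∀ j, M j j ≤ d)
    {v : Fin p → ℝ} (hv : v ≠ 0) (m : ℕ) : ∀ u : Fin p → ℝ,
    ∃ (T : Finset (Fin p)) (y : Fin p → ℝ), T.card ≤ m ∧ (∀ j ∉ T, y j = 0) ∧
      (u + y) ⬝ᵥ (M *ᵥ (u + y)) ≤ u ⬝ᵥ (M *ᵥ u) + m * (u ⬝ᵥ (M *ᵥ v) + v ⬝ᵥ (M *ᵥ u))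
        + m * (m - 1) * (v ⬝ᵥ (M *ᵥ v)) + m * (l1Norm v ^ 2 * d) := by
  induction m with
  | zero => exact fun u => ⟨∅, 0, by simp, by simp, by simp⟩
  | succ m ih =>
    intro u
    -- The linear term collects the interaction with `u` and with the `m` summands still to come,
    -- each replaced by its mean `v`.
    obtain ⟨i, a, hia⟩ := exists_single_quadForm_le M hd hv
      (u ᵥ* M + M *ᵥ u + (m : ℝ) • (M *ᵥ v + v ᵥ* M))
    set y₀ : Fin p → ℝ := Pi.single i a with hy₀
    obtain ⟨T, y, hT, hy, hle⟩ := ih (u + y₀)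
    refine ⟨insert i T, y₀ + y, (Finset.card_insert_le _ _).trans (by omega), fun j hj => ?_, ?_⟩
    · rw [Finset.mem_insert, not_or] at hj
      simp [hy₀, hy j hj.2, hj.1]
    · rw [← add_assoc]
      refine hle.trans ?_
      have tr : ∀ x y : Fin p → ℝ, x ⬝ᵥ (y ᵥ* M) = y ⬝ᵥ (M *ᵥ x) := fun x y => by
        rw [dotProduct_comm, ← Matrix.dotProduct_mulVec]
      simp only [dotProduct_add, dotProduct_smul, smul_eq_mul, tr] at hia
      simp only [Matrix.mulVec_add, dotProduct_add, add_dotProduct]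
      push_cast
      nlinarith

/-- A quadratic form that is nonnegative on sparse vectors is bounded below on all vectors by a
multiple of the squared `ℓ¹`-norm. -/
theorem quadForm_ge_of_sparse_nonneg {M : Matrix (Fin p) (Fin p) ℝ} {d : ℝ} (hd : ∀ j, M j j ≤ d)
    {m : ℕ} (hm : 2 ≤ m)
    (hM : ∀ (T : Finset (Fin p)) (y : Fin p → ℝ), T.card ≤ m → (∀ j ∉ T, y j = 0) →
      0 ≤ y ⬝ᵥ (M *ᵥ y)) (v : Fin p → ℝ) :
    -(d * l1Norm v ^ 2 / (m - 1)) ≤ v ⬝ᵥ (M *ᵥ v) := by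
  have hm' : (2 : ℝ) ≤ m := by exact_mod_cast hm
  by_cases hv : v = 0
  · subst hv; simp [l1Norm]
  -- Starting from zero, the sparse vector has form at most `m(m - 1) vᵀMv + m d ‖v‖₁²`. Its
  -- nonnegativity gives the claim on division by `m(m - 1)`.
  obtain ⟨T, y, hT, hy, hle⟩ := exists_sparse_quadForm_le M hd hv m 0
  have h0 := hM T y hT hy
  simp only [zero_add, zero_dotProduct, Matrix.mulVec_zero, dotProduct_zero, add_zero,
    mul_zero] at hle
  have h1 : 0 ≤ (m : ℝ) * ((m - 1) * (v ⬝ᵥ (M *ᵥ v)) + l1Norm v ^ 2 * d) := by linarith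
  have h2 := nonneg_of_mul_nonneg_right h1 (by linarith)
  rw [neg_le, ← sub_nonneg]
  have h3 : d * l1Norm v ^ 2 / (m - 1) - -(v ⬝ᵥ (M *ᵥ v))
    = ((m - 1) * (v ⬝ᵥ (M *ᵥ v)) + l1Norm v ^ 2 * d) / (m - 1) := by
      have : (m : ℝ) - 1 ≠ 0 := by linarith
      field_simp
      ring
  rw [h3]
  exact div_nonneg h2 (by linarith)

/-- Restricted eigenvalue bound: a perturbation that is small on sparse vectors. -/
theorem quadForm_ge_of_sparse_bilin_le {D : Matrix (Fin p) (Fin p) ℝ} {δ : ℝ}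
    {m : ℕ} (hm : 2 ≤ m)
    (hD : ∀ T : Finset (Fin p), T.card ≤ m → ∀ x y : Fin p → ℝ, (∀ j ∉ T, x j = 0) →
      (∀ j ∉ T, y j = 0) → |x ⬝ᵥ (D *ᵥ y)| ≤ δ * (√(x ⬝ᵥ x) * √(y ⬝ᵥ y))) (v : Fin p → ℝ) :
    -(δ * (v ⬝ᵥ v)) - 2 * δ * l1Norm v ^ 2 / (m - 1) ≤ v ⬝ᵥ (D *ᵥ v) := by
  have hq : ∀ y : Fin p → ℝ, y ⬝ᵥ ((D + δ • (1 : Matrix (Fin p) (Fin p) ℝ)) *ᵥ y)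
      = y ⬝ᵥ (D *ᵥ y) + δ * (y ⬝ᵥ y) := fun y => by
    rw [Matrix.add_mulVec, dotProduct_add, Matrix.smul_mulVec, Matrix.one_mulVec, dotProduct_smul,
      smul_eq_mul]
  have hsp : ∀ (T : Finset (Fin p)) (y : Fin p → ℝ), T.card ≤ m → (∀ j ∉ T, y j = 0) →
      |y ⬝ᵥ (D *ᵥ y)| ≤ δ * (y ⬝ᵥ y) := fun T y hT hy => by
    have := hD T hT y y hy hy
    rwa [Real.mul_self_sqrt (dotProduct_self_nonneg' y)] at this
  -- Shifting by `δ I` makes the form nonnegative on sparse vectors; the diagonal is then at most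
  -- `2δ`.
  have := quadForm_ge_of_sparse_nonneg (M := D + δ • (1 : Matrix (Fin p) (Fin p) ℝ))
    (d := 2 * δ) (fun j => ?_) hm (fun T y hT hy => ?_) v
  · rw [hq] at this
    linarith
  · have h := (le_abs_self _).trans (hsp {j} (Pi.single j 1) (by simp; omega)
      (fun i hi => by simp_all))
    simp at h
    simp only [Matrix.add_apply, Matrix.smul_apply, Matrix.one_apply_eq, smul_eq_mul, mul_one]
    linarith
  · rw [hq]
    linarith [neg_abs_le (y ⬝ᵥ (D *ᵥ y)), hsp T y hT hy]

end SparseToDense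

/-! ### First-order conditions for stationary points and minimizers. -/

section Optimization

variable {p : ℕ}

theorem quadLoss_add {Γ : Matrix (Fin p) (Fin p) ℝ} (hΓ : Γ.IsHermitian) (γ b d : Fin p → ℝ) (t : ℝ) :
    quadLoss Γ γ (b + t • d) = quadLoss Γ γ b + t * ((Γ *ᵥ b - γ) ⬝ᵥ d)
      + t ^ 2 * (d ⬝ᵥ (Γ *ᵥ d) / 2) := by
  have hs : d ⬝ᵥ (Γ *ᵥ b) = b ⬝ᵥ (Γ *ᵥ d) := by
    rw [Matrix.dotProduct_mulVec, dotProduct_comm, ← Matrix.mulVec_transpose]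
    have : Γᵀ = Γ := by simpa using hΓ.eq
    rw [this]
  simp only [quadLoss, Matrix.mulVec_add, Matrix.mulVec_smul, add_dotProduct, dotProduct_add,
    smul_dotProduct, dotProduct_smul, smul_eq_mul, sub_dotProduct, hs]
  rw [dotProduct_comm (Γ *ᵥ b) d, hs]
  ring

theorem differentiable_quadLoss (Γ : Matrix (Fin p) (Fin p) ℝ) (γ : Fin p → ℝ) :
    Differentiable ℝ (quadLoss Γ γ) := by
  unfold quadLoss Matrix.mulVec dotProduct
  fun_prop

theorem fderiv_quadLoss {Γ : Matrix (Fin p) (Fin p) ℝ} (hΓ : Γ.IsHermitian) (γ b d : Fin p → ℝ) :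
    fderiv ℝ (quadLoss Γ γ) b d = (Γ *ᵥ b - γ) ⬝ᵥ d := by
  rw [← (differentiable_quadLoss Γ γ b).lineDeriv_eq_fderiv, lineDeriv]
  simp_rw [quadLoss_add hΓ]
  have h := (((hasDerivAt_id (0 : ℝ)).mul_const ((Γ *ᵥ b - γ) ⬝ᵥ d)).const_add
    (quadLoss Γ γ b)).add ((hasDerivAt_pow 2 (0 : ℝ)).mul_const (d ⬝ᵥ (Γ *ᵥ d) / 2))
  refine HasDerivAt.deriv ?_
  convert h using 1
  · rfl
  · simp

/-- The directional derivative of the absolute value at `b` in the direction `d`. -/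
noncomputable def absDir (b d : ℝ) : ℝ := if b = 0 then |d| else SignType.sign b * d

theorem absDir_le (b d : ℝ) : absDir b d ≤ |b + d| - |b| := by
  unfold absDir
  split_ifs with h
  · simp [h]
  · rcases lt_or_gt_of_ne h with h | h
    · rw [sign_neg h, abs_of_neg h, SignType.coe_neg, SignType.coe_one]; linarith [neg_abs_le (b + d)]
    · rw [sign_pos h, abs_of_pos h, SignType.coe_one]; linarith [le_abs_self (b + d)]

/-- For small `t > 0` the sign of `b + t d` no longer changes, so the expression is eventually
constant. At `b = 0` with `d ≠ 0` the point `t d` avoids the kink; for `d = 0` the factor `d`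
vanishes. -/
theorem tendsto_deriv_abs_mul (lam b d : ℝ) :
    Tendsto (fun t : ℝ => deriv (fun u => lam * |u|) (b + t * d) * d) (𝓝[>] 0)
      (𝓝 (lam * absDir b d)) := by
  have hder : ∀ x : ℝ, x ≠ 0 → deriv (fun u => lam * |u|) x = lam * SignType.sign x :=
    fun x hx => ((hasDerivAt_abs hx).const_mul lam).deriv
  refine tendsto_const_nhds.congr' ?_
  unfold absDir
  split_ifs with h
  · filter_upwards [self_mem_nhdsWithin] with t ht
    rcases eq_or_ne d 0 with hd | hd
    · simp [hd]
    · rw [h, zero_add, hder _ (mul_ne_zero (ne_of_gt ht) hd), sign_mul, sign_pos ht, one_mul,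
        mul_assoc, sign_mul_self]
  · have hc : Tendsto (fun t : ℝ => b + t * d) (𝓝[>] 0) (𝓝 b) := by
      have : Continuous fun t : ℝ => b + t * d := by fun_prop
      simpa using (this.tendsto 0).mono_left nhdsWithin_le_nhds
    rcases lt_or_gt_of_ne h with h | h
    · filter_upwards [hc.eventually (gt_mem_nhds h)] with t ht
      rw [hder _ ht.ne, sign_neg ht, sign_neg h, mul_assoc]
    · filter_upwards [hc.eventually (lt_mem_nhds h)] with t ht
      rw [hder _ ht.ne', sign_pos ht, sign_pos h, mul_assoc]

theorem isStationaryPoint_iff {Γ : Matrix (Fin p) (Fin p) ℝ} (hΓ : Γ.IsHermitian)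
    (γ : Fin p → ℝ) (lam R : ℝ) (b : Fin p → ℝ) :
    IsStationaryPoint (quadLoss Γ γ) (fun u => lam * |u|) R b ↔
      l1Norm b ≤ R ∧ ∀ β, l1Norm β ≤ R →
        0 ≤ (Γ *ᵥ b - γ) ⬝ᵥ (β - b) + ∑ j, lam * absDir (b j) (β j - b j) := by
  have ht : ∀ β : Fin p → ℝ, Tendsto (fun t : ℝ => ∑ j, deriv (fun u => lam * |u|)
      (b j + t * (β j - b j)) * (β j - b j)) (𝓝[>] 0)
      (𝓝 (∑ j, lam * absDir (b j) (β j - b j))) := fun β =>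
    tendsto_finsetSum _ fun j _ => tendsto_deriv_abs_mul lam (b j) (β j - b j)
  refine and_congr_right fun _ => forall₂_congr fun β _ => ?_
  rw [fderiv_quadLoss hΓ]
  refine ⟨fun ⟨D, hD, h⟩ => ?_, fun h => ⟨_, ht β, h⟩⟩
  rwa [← tendsto_nhds_unique hD (ht β)]

/-- Convexity of the absolute value bounds its directional derivative by its increment. Stationary
points thus satisfy the inequality that also holds at minimizers, and one uniqueness argument covers
both. -/
theorem variational_of_isStationaryPoint {Γ : Matrix (Fin p) (Fin p) ℝ} (hΓ : Γ.IsHermitian)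
    {γ : Fin p → ℝ} {lam R : ℝ} (hlam : 0 ≤ lam) {b : Fin p → ℝ}
    (h : IsStationaryPoint (quadLoss Γ γ) (fun u => lam * |u|) R b) {β : Fin p → ℝ}
    (hβ : l1Norm β ≤ R) :
    0 ≤ (Γ *ᵥ b - γ) ⬝ᵥ (β - b) + lam * (l1Norm β - l1Norm b) := by
  refine (((isStationaryPoint_iff hΓ γ lam R b).1 h).2 β hβ).trans ?_
  gcongr
  rw [l1Norm, l1Norm, ← Finset.sum_sub_distrib, Finset.mul_sum]
  gcongr with j
  simpa using absDir_le (b j) (β j - b j)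

theorem convex_l1Norm : ConvexOn ℝ Set.univ (l1Norm : (Fin p → ℝ) → ℝ) := by
  refine ⟨convex_univ, fun x _ y _ a c ha hc _ => ?_⟩
  simp only [l1Norm, smul_eq_mul, Finset.mul_sum, ← Finset.sum_add_distrib]
  refine Finset.sum_le_sum fun j _ => (abs_add_le _ _).trans (le_of_eq ?_)
  simp [abs_mul, abs_of_nonneg ha, abs_of_nonneg hc]

/-- Only the penalty has to be convex: along the segment to `β` the quadratic part of the loss is of
order `t²` and disappears after division by `t`, whatever its sign. -/
theorem variational_of_isMinOn {Γ : Matrix (Fin p) (Fin p) ℝ} (hΓ : Γ.IsHermitian)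
    {γ : Fin p → ℝ} {lam : ℝ} (hlam : 0 ≤ lam) {C : Set (Fin p → ℝ)} (hC : Convex ℝ C)
    {b : Fin p → ℝ} (hb : b ∈ C)
    (hmin : IsMinOn (fun β => quadLoss Γ γ β + lam * l1Norm β) C b) {β : Fin p → ℝ} (hβ : β ∈ C) :
    0 ≤ (Γ *ᵥ b - γ) ⬝ᵥ (β - b) + lam * (l1Norm β - l1Norm b) := by
  set A := (Γ *ᵥ b - γ) ⬝ᵥ (β - b) + lam * (l1Norm β - l1Norm b) with hA
  set B := (β - b) ⬝ᵥ (Γ *ᵥ (β - b)) / 2 with hB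
  have key : ∀ t : ℝ, 0 < t → t ≤ 1 → 0 ≤ A + t * B := by
    intro t ht0 ht1
    have hmem : b + t • (β - b) ∈ C := hC.add_smul_sub_mem hb hβ ⟨ht0.le, ht1⟩
    have h1 := hmin hmem
    simp only [Set.mem_ofPred_eq] at h1
    rw [quadLoss_add hΓ] at h1
    have h2 : l1Norm (b + t • (β - b)) ≤ (1 - t) * l1Norm b + t * l1Norm β := by
      have := convex_l1Norm.2 (Set.mem_univ b) (Set.mem_univ β) (sub_nonneg.2 ht1) ht0.le
        (by ring)
      have e : b + t • (β - b) = (1 - t) • b + t • β := by module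
      rwa [e]
    have h3 := mul_le_mul_of_nonneg_left h2 hlam
    have h4 : 0 ≤ t * (A + t * B) := by rw [hA]; nlinarith
    exact nonneg_of_mul_nonneg_right h4 ht0
  have hlim : Tendsto (fun t : ℝ => A + t * B) (𝓝[>] 0) (𝓝 A) := by
    have : Continuous fun t : ℝ => A + t * B := by fun_prop
    simpa using (this.tendsto 0).mono_left nhdsWithin_le_nhds
  refine ge_of_tendsto hlim ?_
  filter_upwards [Ioo_mem_nhdsGT (show (0 : ℝ) < 1 by norm_num)] with t ht
  exact key t ht.1 ht.2.le

theorem continuous_l1Norm : Continuous (l1Norm : (Fin p → ℝ) → ℝ) := by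
  unfold l1Norm; fun_prop

theorem exists_isMinOn_of_l1Norm_le (Γ : Matrix (Fin p) (Fin p) ℝ) (γ : Fin p → ℝ) (lam R : ℝ)
    {C : Set (Fin p → ℝ)} (hC : IsClosed C) (hne : C.Nonempty) (hR : ∀ β ∈ C, l1Norm β ≤ R) :
    ∃ b ∈ C, IsMinOn (fun β => quadLoss Γ γ β + lam * l1Norm β) C b := by
  have hbd : Bornology.IsBounded C := by
    refine (Metric.isBounded_closedBall (x := (0 : Fin p → ℝ)) (r := R)).subset fun β hβ => ?_
    rw [mem_closedBall_zero_iff]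
    have h0 : 0 ≤ R := (l1Norm_nonneg β).trans (hR β hβ)
    refine (pi_norm_le_iff_of_nonneg h0).2 fun j => ?_
    exact (Finset.single_le_sum (f := fun j => |β j|) (fun i _ => abs_nonneg _)
      (Finset.mem_univ j)).trans (hR β hβ)
  exact (Metric.isCompact_of_isClosed_isBounded hC hbd).exists_isMinOn hne
    ((differentiable_quadLoss Γ γ).continuous.add
      (continuous_const.mul continuous_l1Norm)).continuousOn

theorem isGlobalOptimum_iff (L : (Fin p → ℝ) → ℝ) (lam R : ℝ) (b : Fin p → ℝ) :
    IsGlobalOptimum L (fun u => lam * |u|) R b ↔ l1Norm b ≤ R ∧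
      IsMinOn (fun β => L β + lam * l1Norm β) {β | l1Norm β ≤ R} b := by
  simp only [IsGlobalOptimum, ← Finset.mul_sum]
  rfl

end Optimization

/-! ### The primal-dual witness argument. -/

section PrimalDualWitness

variable {p : ℕ}

theorem mem_supp {v : Fin p → ℝ} {j : Fin p} : j ∈ supp v ↔ v j ≠ 0 := by
  classical
  simp [supp]

theorem abs_dotProduct_le_mul_l1Norm {g : Fin p → ℝ} {a : ℝ} (hg : ∀ j, |g j| ≤ a)
    (v : Fin p → ℝ) : |g ⬝ᵥ v| ≤ a * l1Norm v := by
  rw [dotProduct, l1Norm, Finset.mul_sum]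
  refine (Finset.abs_sum_le_sum_abs _ _).trans (Finset.sum_le_sum fun j _ => ?_)
  rw [abs_mul]
  exact mul_le_mul_of_nonneg_right (hg j) (abs_nonneg _)

theorem sq_sum_abs_le (S : Finset (Fin p)) (v : Fin p → ℝ) :
    (∑ j ∈ S, |v j|) ^ 2 ≤ S.card * (v ⬝ᵥ v) := by
  refine sq_sum_le_card_mul_sum_sq.trans ?_
  gcongr
  simp only [sq_abs, dotProduct, ← sq]
  exact Finset.sum_le_univ_sum_of_nonneg fun j => sq_nonneg _

theorem l1Norm_eq_sum_of_support {S : Finset (Fin p)} {v : Fin p → ℝ} (hv : ∀ j ∉ S, v j = 0) :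
    l1Norm v = ∑ j ∈ S, |v j| := by
  symm
  exact Finset.sum_subset (Finset.subset_univ S) fun j _ hj => by simp [hv j hj]

/-- Restricted strong convexity gives strong convexity on vectors supported in a small set. -/
theorem quadForm_ge_of_support {Γ : Matrix (Fin p) (Fin p) ℝ} {α τ : ℝ} {S : Finset (Fin p)}
    (hτ : 0 ≤ τ) (hRE : ∀ v, α * (v ⬝ᵥ v) - τ * l1Norm v ^ 2 ≤ v ⬝ᵥ (Γ *ᵥ v))
    (hS : 4 * τ * S.card ≤ α) {v : Fin p → ℝ} (hv : ∀ j ∉ S, v j = 0) :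
    α / 2 * (v ⬝ᵥ v) ≤ v ⬝ᵥ (Γ *ᵥ v) := by
  have h1 := hRE v
  have h2 := sq_sum_abs_le S v
  rw [← l1Norm_eq_sum_of_support hv] at h2
  have h3 := mul_le_mul_of_nonneg_left h2 hτ
  have h4 := dotProduct_self_nonneg' v
  nlinarith

/-- A point with `∇L(b) + λ z = 0` for a subgradient `z` which is strictly feasible off `S` is the
only solution of the variational inequality. -/
theorem eq_of_variational {Γ : Matrix (Fin p) (Fin p) ℝ} {γ b β : Fin p → ℝ} {lam R α τ θ : ℝ}
    {S : Finset (Fin p)} (hτ : 0 ≤ τ) (hα : 0 < α)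
    (hRE : ∀ v, α * (v ⬝ᵥ v) - τ * l1Norm v ^ 2 ≤ v ⬝ᵥ (Γ *ᵥ v))
    (hS : 4 * τ * S.card ≤ α) (hR : 4 * τ * R ≤ lam - θ)
    (hb : l1Norm b ≤ R) (hbS : ∀ j ∉ S, b j = 0)
    (hsub : ∀ j, (Γ *ᵥ b - γ) j * b j = -(lam * |b j|))
    (hon : ∀ j, |(Γ *ᵥ b - γ) j| ≤ lam) (hoff : ∀ j ∉ S, |(Γ *ᵥ b - γ) j| ≤ θ)
    (hβ : l1Norm β ≤ R)
    (hvar : 0 ≤ (Γ *ᵥ β - γ) ⬝ᵥ (b - β) + lam * (l1Norm b - l1Norm β)) : β = b := by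
  classical
  set g := Γ *ᵥ b - γ with hg
  set ν := β - b with hν
  have hquad : ν ⬝ᵥ (Γ *ᵥ ν) = (Γ *ᵥ β - γ) ⬝ᵥ ν - g ⬝ᵥ ν := by
    rw [← sub_dotProduct, hg, sub_sub_sub_cancel_right, ← Matrix.mulVec_sub, dotProduct_comm]
  have hvar' : (Γ *ᵥ β - γ) ⬝ᵥ ν ≤ lam * (l1Norm b - l1Norm β) := by
    have : b - β = -ν := by rw [hν]; abel
    rw [this, dotProduct_neg] at hvar
    linarith
  have hgb : g ⬝ᵥ b = -(lam * l1Norm b) := by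
    rw [dotProduct, l1Norm, Finset.mul_sum, ← Finset.sum_neg_distrib]
    exact Finset.sum_congr rfl fun j _ => hsub j
  set N := ∑ j ∈ Sᶜ, |ν j| with hN
  have hN0 : 0 ≤ N := Finset.sum_nonneg fun _ _ => abs_nonneg _
  have hgβ : -(lam * l1Norm β) + (lam - θ) * N ≤ g ⬝ᵥ β := by
    have h1 : lam * l1Norm β - (lam - θ) * N
        = ∑ j, (lam * |β j| - if j ∈ Sᶜ then (lam - θ) * |ν j| else 0) := by
      rw [Finset.sum_sub_distrib, ← Finset.mul_sum, Finset.sum_ite_mem, Finset.univ_inter,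
        ← Finset.mul_sum]
      rfl
    have h2 : -(g ⬝ᵥ β) ≤ lam * l1Norm β - (lam - θ) * N := by
      rw [h1, dotProduct, ← Finset.sum_neg_distrib]
      refine Finset.sum_le_sum fun j _ => ?_
      have h3 : -(g j * β j) ≤ |g j| * |β j| := by rw [← abs_mul]; exact neg_le_abs _
      by_cases hj : j ∈ S
      · rw [if_neg (by simpa using hj)]
        nlinarith [hon j, abs_nonneg (β j)]
      · rw [if_pos (by simpa using hj)]
        have : ν j = β j := by simp [hν, hbS j hj]
        rw [this]
        nlinarith [hoff j hj, abs_nonneg (β j)]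
    linarith
  -- The variational inequality at `β` and the subgradient equation at `b` combine. The gap `lam -
  -- θ` off `S` yields the additional linear term in `N = ‖ν_{Sᶜ}‖₁`.
  have hmain : ν ⬝ᵥ (Γ *ᵥ ν) + (lam - θ) * N ≤ 0 := by
    have : g ⬝ᵥ ν = g ⬝ᵥ β - g ⬝ᵥ b := by rw [hν, dotProduct_sub]
    rw [hquad, this, hgb]
    linarith
  have hsplit : l1Norm ν = ∑ j ∈ S, |ν j| + N := (Finset.sum_add_sum_compl S _).symm
  have hNR : N ≤ 2 * R := by
    have h1 : N ≤ l1Norm ν := by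
      rw [hsplit]; linarith [Finset.sum_nonneg fun j (_ : j ∈ S) => abs_nonneg (ν j)]
    have h2 : l1Norm ν ≤ l1Norm β + l1Norm b := by
      simp only [l1Norm, ← Finset.sum_add_distrib]
      exact Finset.sum_le_sum fun j _ => abs_sub _ _
    linarith
  have h1 := hRE ν
  have h2 := sq_sum_abs_le S ν
  -- One factor of `N²` is replaced by `2R`, making it linear in `N`. After multiplication by `τ`,
  -- `hS` bounds the first part by `α/2 ‖ν‖₂²` and `hR` bounds the second by the dual gap, so `α/2
  -- ‖ν‖₂² ≤ 0`.
  have h3 : l1Norm ν ^ 2 ≤ 2 * (S.card * (ν ⬝ᵥ ν)) + 2 * (N * (2 * R)) := by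
    rw [hsplit]
    nlinarith [sq_nonneg (∑ j ∈ S, |ν j| - N), mul_le_mul_of_nonneg_left hNR hN0]
  have h4 := mul_le_mul_of_nonneg_left h3 hτ
  have h5 := dotProduct_self_nonneg' ν
  have h6 := mul_le_mul_of_nonneg_right hS h5
  have h7 := mul_le_mul_of_nonneg_right hR hN0
  have h8 : ν ⬝ᵥ ν = 0 := by nlinarith
  exact sub_eq_zero.1 (dotProduct_self_eq_zero.1 h8)

/-- The gradient of a minimizer of the penalized loss over vectors supported in `S` that is
interior to the `ℓ¹`-ball. -/
theorem subgradient_of_variational {g b : Fin p → ℝ} {lam R : ℝ} {S : Finset (Fin p)}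
    (hlam : 0 ≤ lam)
    (hbR : l1Norm b < R) (hbS : ∀ j ∉ S, b j = 0)
    (hvar : ∀ β, l1Norm β ≤ R → (∀ j ∉ S, β j = 0) →
      0 ≤ g ⬝ᵥ (β - b) + lam * (l1Norm β - l1Norm b)) :
    ∀ j ∈ S, |g j| ≤ lam ∧ g j * b j = -(lam * |b j|) := by
  intro j hj
  have step : ∀ s : ℝ, |s| ≤ R - l1Norm b → 0 ≤ g j * s + lam * (|b j + s| - |b j|) := by
    intro s hs
    have hdiff : l1Norm (b + Pi.single j s) - l1Norm b = |b j + s| - |b j| := by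
      simp only [l1Norm, ← Finset.sum_sub_distrib]
      rw [Finset.sum_eq_single j]
      · simp
      · intro i _ hi; simp [hi]
      · simp
    have h := hvar (b + Pi.single j s) (by
      have : |b j + s| ≤ |b j| + |s| := abs_add_le _ _
      linarith) (fun i hi => by
        have : i ≠ j := fun h => hi (h ▸ hj)
        simp [hbS i hi, this])
    rw [hdiff, add_sub_cancel_left, dotProduct_single] at h
    exact h
  have hpos : 0 < R - l1Norm b := by linarith
  have hle : |g j| ≤ lam := by
    set s := R - l1Norm b
    have h1 := step s (by rw [abs_of_pos hpos])
    have h2 := step (-s) (by rw [abs_neg, abs_of_pos hpos])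
    have h3 : |b j + s| - |b j| ≤ s := by
      have := abs_add_le (b j) s; rw [abs_of_pos hpos] at this; linarith
    have h4 : |b j + -s| - |b j| ≤ s := by
      have := abs_add_le (b j) (-s); rw [abs_neg, abs_of_pos hpos] at this; linarith
    have h5 := mul_le_mul_of_nonneg_left h3 hlam
    have h6 := mul_le_mul_of_nonneg_left h4 hlam
    rw [abs_le]
    constructor <;> nlinarith
  refine ⟨hle, ?_⟩
  rcases eq_or_ne (b j) 0 with h0 | h0
  · simp [h0]
  · have hb0 : 0 < |b j| := abs_pos.2 h0
    -- Shrinking `b j` by the factor `1 - r` is an admissible move that does not cross zero, so the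
    -- penalty changes linearly along it.
    set r := min 1 ((R - l1Norm b) / |b j|) with hr
    have hr0 : 0 < r := lt_min one_pos (div_pos hpos hb0)
    have hr1 : r ≤ 1 := min_le_left _ _
    have h1 := step (-(r * b j)) (by
      rw [abs_neg, abs_mul, abs_of_pos hr0]
      exact (le_div_iff₀ hb0).1 (min_le_right _ _))
    have e : b j + -(r * b j) = (1 - r) * b j := by ring
    rw [e, abs_mul, abs_of_nonneg (sub_nonneg.2 hr1)] at h1
    have h2 : 0 ≤ r * (-(g j * b j) - lam * |b j|) := by linarith
    have h3 := nonneg_of_mul_nonneg_right h2 hr0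
    have h4 : -(g j * b j) ≤ |g j| * |b j| := by rw [← abs_mul]; exact neg_le_abs _
    nlinarith

theorem isStationaryPoint_of_subgradient {Γ : Matrix (Fin p) (Fin p) ℝ} (hΓ : Γ.IsHermitian)
    {γ b : Fin p → ℝ} {lam R : ℝ} (hb : l1Norm b ≤ R)
    (hsub : ∀ j, (Γ *ᵥ b - γ) j * b j = -(lam * |b j|))
    (hon : ∀ j, |(Γ *ᵥ b - γ) j| ≤ lam) :
    IsStationaryPoint (quadLoss Γ γ) (fun u => lam * |u|) R b := by
  rw [isStationaryPoint_iff hΓ]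
  refine ⟨hb, fun β _ => ?_⟩
  rw [dotProduct, ← Finset.sum_add_distrib]
  refine Finset.sum_nonneg fun j _ => ?_
  generalize hg : (Γ *ᵥ b - γ) j = g
  have h1 := hsub j
  have h2 := hon j
  rw [hg] at h1 h2
  simp only [Pi.sub_apply]
  unfold absDir
  split_ifs with h
  · have : -(g * (β j - b j)) ≤ |g| * |β j - b j| := by rw [← abs_mul]; exact neg_le_abs _
    nlinarith [abs_nonneg (β j - b j)]
  · have h3 : g = -(lam * SignType.sign (b j)) := by
      refine mul_right_cancel₀ h ?_
      rw [h1, neg_mul, mul_assoc, sign_mul_self]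
    rw [h3]
    exact le_of_eq (by ring)

theorem abs_mulVec_le_opNormInf {m l : Type*} [Fintype m] [Fintype l] (A : Matrix m l ℝ)
    {v : l → ℝ} {a : ℝ} (ha : 0 ≤ a) (hv : ∀ j, |v j| ≤ a) (i : m) :
    |(A *ᵥ v) i| ≤ opNormInf A * a := by
  let _ := Matrix.linftyOpNormedAddCommGroup (m := m) (n := l) (α := ℝ)
  have h1 : ‖A *ᵥ v‖ ≤ opNormInf A * ‖v‖ := Matrix.linfty_opNorm_mulVec A v
  have h2 : ‖v‖ ≤ a := (pi_norm_le_iff_of_nonneg ha).2 hv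
  have h3 : 0 ≤ opNormInf A := norm_nonneg A
  exact (norm_le_pi_norm (A *ᵥ v) i).trans (h1.trans (mul_le_mul_of_nonneg_left h2 h3))

theorem opNormInf_nonneg {m l : Type*} [Fintype m] [Fintype l] (A : Matrix m l ℝ) :
    0 ≤ opNormInf A :=
  letI := Matrix.linftyOpNormedAddCommGroup (m := m) (n := l) (α := ℝ)
  norm_nonneg A

theorem toBlock_mulVec_restrict {S : Finset (Fin p)} (Γ : Matrix (Fin p) (Fin p) ℝ)
    (q : Fin p → Prop) {v : Fin p → ℝ} (hv : ∀ j ∉ S, v j = 0) :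
    Γ.toBlock q (· ∈ S) *ᵥ (fun j : {j // j ∈ S} => v j) = fun i : {i // q i} => (Γ *ᵥ v) i := by
  ext i
  simp only [Matrix.mulVec, dotProduct, Matrix.toBlock_apply]
  rw [Finset.sum_coe_sort S (fun j => Γ i j * v j)]
  exact Finset.sum_subset (Finset.subset_univ S) fun j _ hj => by simp [hv j hj]

/-- The extension by zero of a vector indexed by `S`. -/
noncomputable def extendZero (S : Finset (Fin p)) (v : {j // j ∈ S} → ℝ) : Fin p → ℝ :=
  fun j => if h : j ∈ S then v ⟨j, h⟩ else 0

theorem extendZero_of_notMem {S : Finset (Fin p)} (v : {j // j ∈ S} → ℝ) :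
    ∀ j ∉ S, extendZero S v j = 0 := fun _ hj => dif_neg hj

theorem extendZero_coe {S : Finset (Fin p)} (v : {j // j ∈ S} → ℝ) :
    (fun j : {j // j ∈ S} => extendZero S v j) = v := by
  ext j; simp [extendZero]

/-- The primal-dual witness argument. -/
theorem lasso_unique_of_deterministic {Γ : Matrix (Fin p) (Fin p) ℝ} (hΓ : Γ.IsHermitian)
    {γ βs : Fin p → ℝ} {lam R α τ η ρ cinf r : ℝ} (hτ : 0 ≤ τ) (hα : 0 < α)
    (hRE : ∀ v, α * (v ⬝ᵥ v) - τ * l1Norm v ^ 2 ≤ v ⬝ᵥ (Γ *ᵥ v))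
    (hS : 4 * τ * (supp βs).card ≤ α) (hR : 4 * τ * R ≤ lam * (1 - η) / 2) (hr : 0 ≤ r)
    (hη : η < 1) (hlam : 0 < lam) (hR0 : 0 < R) (hβs : l1Norm βs ≤ R / 2) (hρ : 0 ≤ ρ)
    (he : ∀ j, |(γ - Γ *ᵥ βs) j| ≤ ρ) (hρ1 : ρ ≤ lam / 4) (hρ2 : ρ ≤ lam * (1 - η) / 4)
    (hinv : ∀ u : Fin p → ℝ, (∀ j ∉ supp βs, u j = 0) →
      (∀ j ∈ supp βs, (Γ *ᵥ u) j = (γ - Γ *ᵥ βs) j) → ∀ j, |u j| ≤ r)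
    (hdet : IsUnit (Γ.toBlock (· ∈ supp βs) (· ∈ supp βs)).det)
    (hcinf : opNormInf (Γ.toBlock (· ∈ supp βs) (· ∈ supp βs))⁻¹ ≤ cinf)
    (hinc : opNormInf (Γ.toBlock (· ∉ supp βs) (· ∈ supp βs) *
      (Γ.toBlock (· ∈ supp βs) (· ∈ supp βs))⁻¹) ≤ η) :
    ∃ βhat : Fin p → ℝ,
      (∀ β, IsStationaryPoint (quadLoss Γ γ) (fun u => lam * |u|) R β ↔ β = βhat) ∧
      (∀ β, IsGlobalOptimum (quadLoss Γ γ) (fun u => lam * |u|) R β ↔ β = βhat) ∧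
      supp βhat ⊆ supp βs ∧ ‖βhat - βs‖ ≤ r + cinf * lam := by
  classical
  set S := supp βs with hSdef
  set e := γ - Γ *ᵥ βs with hedef
  have hβsS : ∀ j ∉ S, βs j = 0 := fun j hj => by
    by_contra h; exact hj (mem_supp.2 h)
  set C : Set (Fin p → ℝ) := {β | l1Norm β ≤ R ∧ ∀ j ∉ S, β j = 0} with hC
  have hball : Convex ℝ {β : Fin p → ℝ | l1Norm β ≤ R} := by
    simpa using convex_l1Norm.convex_le R
  have hCconv : Convex ℝ C := by
    refine hball.inter (t := {β : Fin p → ℝ | ∀ j ∉ S, β j = 0}) ?_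
    intro x hx y hy a c _ _ _ j hj
    simp [hx j hj, hy j hj]
  have hCclosed : IsClosed C := by
    refine (isClosed_le continuous_l1Norm continuous_const).inter
      (s₂ := {β : Fin p → ℝ | ∀ j ∉ S, β j = 0}) ?_
    have : {β : Fin p → ℝ | ∀ j ∉ S, β j = 0} = ⋂ j, ⋂ (_ : j ∉ S), {β | β j = 0} := by
      ext; simp
    rw [this]
    exact isClosed_iInter fun j => isClosed_iInter fun _ =>
      isClosed_eq (continuous_apply j) continuous_const
  have hβsC : βs ∈ C := ⟨by linarith, hβsS⟩
  -- The primal witness: a minimizer under the additional constraint of support in `S`.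
  obtain ⟨b, ⟨hbR, hbS⟩, hmin⟩ := exists_isMinOn_of_l1Norm_le Γ γ lam R hCclosed ⟨βs, hβsC⟩
    fun β hβ => hβ.1
  have hvar := fun β (hβ : β ∈ C) => variational_of_isMinOn hΓ hlam.le hCconv ⟨hbR, hbS⟩ hmin hβ
  set g := Γ *ᵥ b - γ with hg
  set d := b - βs with hd
  have hdS : ∀ j ∉ S, d j = 0 := fun j hj => by simp [hd, hbS j hj, hβsS j hj]
  have hgd : g = Γ *ᵥ d - e := by
    rw [hg, hd, hedef, Matrix.mulVec_sub]; abel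
  -- the restricted minimizer is interior to the `ℓ¹`-ball
  have hint : l1Norm b < R := by
    have h1 := hvar βs hβsC
    have h2 : βs - b = -d := by rw [hd]; abel
    rw [h2, dotProduct_neg, hgd, sub_dotProduct, dotProduct_comm (Γ *ᵥ d)] at h1
    have h3 := quadForm_ge_of_support hτ hRE hS hdS
    have h4 := dotProduct_self_nonneg' d
    have h5 := (le_abs_self _).trans (abs_dotProduct_le_mul_l1Norm he d)
    have h6 : l1Norm d ≤ l1Norm b + l1Norm βs := by
      simp only [l1Norm, ← Finset.sum_add_distrib]
      exact Finset.sum_le_sum fun j _ => abs_sub _ _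
    have h7 : ρ * l1Norm d ≤ lam / 4 * (l1Norm b + l1Norm βs) :=
      mul_le_mul hρ1 h6 (l1Norm_nonneg d) (by linarith)
    have h8 : 0 ≤ α / 2 * (d ⬝ᵥ d) := by positivity
    -- Hence `‖b‖₁ ≤ (5/3)‖β*‖₁ ≤ 5R/6 < R`.
    have h9 : 0 ≤ lam * (5 / 4 * l1Norm βs - 3 / 4 * l1Norm b) := by linarith
    have := nonneg_of_mul_nonneg_right h9 hlam
    linarith
  have hKKT := subgradient_of_variational (g := g) hlam.le hint hbS
    fun β h1 h2 => hvar β ⟨h1, h2⟩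
  -- strict dual feasibility
  have hsolve : ∀ v : {j // j ∈ S} → ℝ, Γ.toBlock (· ∈ S) (· ∈ S) *ᵥ
      ((Γ.toBlock (· ∈ S) (· ∈ S))⁻¹ *ᵥ v) = v := fun v => by
    rw [Matrix.mulVec_mulVec, Matrix.mul_nonsing_inv _ hdet, Matrix.one_mulVec]
  have hdSS : (fun j : {j // j ∈ S} => d j)
      = (Γ.toBlock (· ∈ S) (· ∈ S))⁻¹ *ᵥ fun j : {j // j ∈ S} => (Γ *ᵥ d) j := by
    rw [← toBlock_mulVec_restrict Γ (· ∈ S) hdS, Matrix.mulVec_mulVec,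
      Matrix.nonsing_inv_mul _ hdet, Matrix.one_mulVec]
  have hΓd : ∀ j, (Γ *ᵥ d) j = e j + g j := fun j => by rw [hgd]; simp
  have hoff : ∀ j ∉ S, |g j| ≤ lam * (1 + η) / 2 := by
    intro j hj
    -- Eliminating `d` through the equations on `S` gives `g_{Sᶜ} = Γ_{SᶜS}Γ_SS⁻¹(e_S + g_S) -
    -- e_{Sᶜ}`. This is at most `η(ρ + λ) + ρ ≤ λ(1 + η)/2`, since `ρ ≤ λ(1 - η)/4` and `η < 1`.
    have h1 : (Γ *ᵥ d) j = ((Γ.toBlock (· ∉ S) (· ∈ S) * (Γ.toBlock (· ∈ S) (· ∈ S))⁻¹) *ᵥ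
        fun j : {j // j ∈ S} => (Γ *ᵥ d) j) ⟨j, hj⟩ := by
      rw [← Matrix.mulVec_mulVec, ← hdSS, toBlock_mulVec_restrict Γ (· ∉ S) hdS]
    have h2 := abs_mulVec_le_opNormInf
      (Γ.toBlock (· ∉ S) (· ∈ S) * (Γ.toBlock (· ∈ S) (· ∈ S))⁻¹)
      (v := fun j : {j // j ∈ S} => (Γ *ᵥ d) j) (a := ρ + lam) (by linarith)
      (fun i => by
        rw [hΓd]
        exact (abs_add_le _ _).trans (add_le_add (he i) (hKKT i i.2).1)) ⟨j, hj⟩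
    rw [← h1] at h2
    have h3 : g j = (Γ *ᵥ d) j - e j := by rw [hΓd]; ring
    have h4 := abs_sub ((Γ *ᵥ d) j) (e j)
    have h5 := he j
    have h6 := mul_le_mul_of_nonneg_right hinc (show 0 ≤ ρ + lam by linarith)
    rw [h3]
    nlinarith
  have hsub : ∀ j, g j * b j = -(lam * |b j|) := fun j => by
    by_cases hj : j ∈ S
    · exact (hKKT j hj).2
    · simp [hbS j hj]
  have hon : ∀ j, |g j| ≤ lam := fun j => by
    by_cases hj : j ∈ S
    · exact (hKKT j hj).1
    · refine (hoff j hj).trans ?_; nlinarith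
  have huniq : ∀ β, l1Norm β ≤ R →
      0 ≤ (Γ *ᵥ β - γ) ⬝ᵥ (b - β) + lam * (l1Norm b - l1Norm β) → β = b := fun β hβ hv =>
    eq_of_variational hτ hα hRE hS (by linarith) hbR hbS hsub hon hoff hβ hv
  have hglob : ∀ β, IsGlobalOptimum (quadLoss Γ γ) (fun u => lam * |u|) R β → β = b := by
    intro β hβ
    rw [isGlobalOptimum_iff] at hβ
    exact huniq β hβ.1 (variational_of_isMinOn hΓ hlam.le hball hβ.1 hβ.2 hbR)
  refine ⟨b, fun β => ⟨fun h => huniq β h.1 (variational_of_isStationaryPoint hΓ hlam.le h hbR),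
    fun h => h ▸ isStationaryPoint_of_subgradient hΓ hbR hsub hon⟩,
    fun β => ⟨hglob β, fun h => ?_⟩, fun j hj => ?_, ?_⟩
  · obtain ⟨b', hb', hmin'⟩ := exists_isMinOn_of_l1Norm_le Γ γ lam R
      (C := {β : Fin p → ℝ | l1Norm β ≤ R}) (isClosed_le continuous_l1Norm continuous_const)
      ⟨b, hbR⟩ fun β hβ => hβ
    have hopt := (isGlobalOptimum_iff (quadLoss Γ γ) lam R b').2 ⟨hb', hmin'⟩
    rw [h, ← hglob b' hopt]
    exact hopt
  · by_contra h
    exact mem_supp.1 hj (hbS j h)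
  · set u := extendZero S ((Γ.toBlock (· ∈ S) (· ∈ S))⁻¹ *ᵥ fun j : {j // j ∈ S} => e j) with hu
    have hur := hinv u (extendZero_of_notMem _) (fun j hj => by
      have h1 := toBlock_mulVec_restrict Γ (· ∈ S) (extendZero_of_notMem
        ((Γ.toBlock (· ∈ S) (· ∈ S))⁻¹ *ᵥ fun j : {j // j ∈ S} => e j))
      rw [extendZero_coe, hsolve] at h1
      exact (congrFun h1 ⟨j, hj⟩).symm)
    have hc0 : 0 ≤ cinf := (opNormInf_nonneg _).trans hcinf
    have hbound : ∀ j, |d j| ≤ r + cinf * lam := by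
      intro j
      by_cases hj : j ∈ S
      · have h1 : d j = u j + ((Γ.toBlock (· ∈ S) (· ∈ S))⁻¹ *ᵥ
            fun j : {j // j ∈ S} => g j) ⟨j, hj⟩ := by
          have h2 := congrFun hdSS ⟨j, hj⟩
          have h3 : (fun j : {j // j ∈ S} => (Γ *ᵥ d) j)
            = (fun j : {j // j ∈ S} => e j) + fun j : {j // j ∈ S} => g j := by
              ext i; exact hΓd i
          rw [h3, Matrix.mulVec_add] at h2
          simp only [Pi.add_apply] at h2
          rw [h2, hu]
          simp [extendZero, hj]
        rw [h1]
        refine (abs_add_le _ _).trans (add_le_add (hur j) ?_)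
        refine (abs_mulVec_le_opNormInf (Γ.toBlock (· ∈ S) (· ∈ S))⁻¹
          (v := fun j : {j // j ∈ S} => g j) hlam.le (fun i => (hKKT i i.2).1) ⟨j, hj⟩).trans ?_
        gcongr
      · rw [hdS j hj, abs_zero]
        positivity
    exact (pi_norm_le_iff_of_nonneg (by positivity)).2 hbound

end PrimalDualWitness

/-! ### Sup-norm control of the restricted inverse. -/

section RestrictedInverse

variable {p : ℕ}

theorem quadForm_ge_of_spectrum {C : Matrix (Fin p) (Fin p) ℝ} (hC : C.IsHermitian) {κ : ℝ}
    (hκ : ∀ μ ∈ spectrum ℝ C, κ ≤ μ) (v : Fin p → ℝ) : κ * (v ⬝ᵥ v) ≤ v ⬝ᵥ (C *ᵥ v) := by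
  have hpsd : (C - κ • (1 : Matrix (Fin p) (Fin p) ℝ)).PosSemidef := by
    rw [Matrix.posSemidef_iff_isHermitian_and_spectrum_nonneg]
    refine ⟨hC.sub ?_, fun a ha => ?_⟩
    · simp [Matrix.IsHermitian]
    · rw [← Algebra.algebraMap_eq_smul_one, ← spectrum.sub_singleton_eq] at ha
      obtain ⟨μ, hμ, ν, hν, rfl⟩ := ha
      rw [Set.mem_singleton_iff] at hν
      subst hν
      exact sub_nonneg.2 (hκ μ hμ)
  have h := hpsd.dotProduct_mulVec_nonneg v
  rw [star_trivial, Matrix.sub_mulVec, dotProduct_sub, Matrix.smul_mulVec, Matrix.one_mulVec,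
    dotProduct_smul, smul_eq_mul] at h
  linarith

theorem dotProduct_congr_of_support {S : Finset (Fin p)} {x f g : Fin p → ℝ}
    (hx : ∀ j ∉ S, x j = 0) (hfg : ∀ j ∈ S, f j = g j) : x ⬝ᵥ f = x ⬝ᵥ g := by
  refine Finset.sum_congr rfl fun j _ => ?_
  by_cases hj : j ∈ S
  · rw [hfg j hj]
  · rw [hx j hj, zero_mul, zero_mul]

theorem dotProduct_mulVec_comm_of_isHermitian {C : Matrix (Fin p) (Fin p) ℝ} (hC : C.IsHermitian)
    (x y : Fin p → ℝ) : x ⬝ᵥ (C *ᵥ y) = y ⬝ᵥ (C *ᵥ x) := by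
  have : Cᵀ = C := by simpa using hC.eq
  rw [Matrix.dotProduct_mulVec, dotProduct_comm, ← Matrix.mulVec_transpose, this]

/-- The system `C x = f` on `S` is solvable by a vector supported in `S`. -/
theorem exists_restricted_solution {C : Matrix (Fin p) (Fin p) ℝ} {κ : ℝ} (hκ : 0 < κ)
    (hC : ∀ v, κ * (v ⬝ᵥ v) ≤ v ⬝ᵥ (C *ᵥ v)) (S : Finset (Fin p)) (f : Fin p → ℝ) :
    ∃ x : Fin p → ℝ, (∀ j ∉ S, x j = 0) ∧ ∀ j ∈ S, (C *ᵥ x) j = f j := by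
  classical
  set B := C.toBlock (· ∈ S) (· ∈ S) with hB
  have hblock : ∀ v : {j // j ∈ S} → ℝ,
      B *ᵥ v = fun i : {i // i ∈ S} => (C *ᵥ extendZero S v) i := fun v => by
    have := toBlock_mulVec_restrict C (· ∈ S) (extendZero_of_notMem v)
    rwa [extendZero_coe] at this
  have hdet : IsUnit B.det := by
    rw [isUnit_iff_ne_zero]
    intro h0
    obtain ⟨v, hv, hv0⟩ := Matrix.exists_mulVec_eq_zero_iff.2 h0
    rw [hblock] at hv0
    have h1 : extendZero S v ⬝ᵥ (C *ᵥ extendZero S v) = 0 := by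
      rw [dotProduct_congr_of_support (extendZero_of_notMem v) (g := 0)
        fun j hj => congrFun hv0 ⟨j, hj⟩, dotProduct_zero]
    have h2 := hC (extendZero S v)
    have h3 := dotProduct_self_nonneg' (extendZero S v)
    have h4 : extendZero S v ⬝ᵥ extendZero S v = 0 := by nlinarith
    apply hv
    rw [← extendZero_coe v, dotProduct_self_eq_zero.1 h4]
    rfl
  refine ⟨extendZero S (B⁻¹ *ᵥ fun j : {j // j ∈ S} => f j), extendZero_of_notMem _,
    fun j hj => ?_⟩
  have h := hblock (B⁻¹ *ᵥ fun j : {j // j ∈ S} => f j)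
  rw [Matrix.mulVec_mulVec, Matrix.mul_nonsing_inv _ hdet, Matrix.one_mulVec] at h
  exact (congrFun h ⟨j, hj⟩).symm

theorem abs_apply_le_sqrt_dotProduct (v : Fin p → ℝ) (j : Fin p) : |v j| ≤ √(v ⬝ᵥ v) := by
  refine Real.abs_le_sqrt ?_
  rw [sq]
  exact Finset.single_le_sum (f := fun j => v j * v j) (fun i _ => mul_self_nonneg _)
    (Finset.mem_univ j)

/-- Column `j` of `Σ_SS⁻¹`, extended by zero. Being deterministic, it can be used as a fixed
direction in the concentration bound. Its length is at most `1/κ` because `κ‖a‖² ≤ aᵀCa = a j ≤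
‖a‖`. -/
theorem exists_restricted_inverse_column {C : Matrix (Fin p) (Fin p) ℝ} {κ : ℝ} (hκ : 0 < κ)
    (hC : ∀ v, κ * (v ⬝ᵥ v) ≤ v ⬝ᵥ (C *ᵥ v)) (S : Finset (Fin p)) (j : Fin p) :
    ∃ a : Fin p → ℝ, (∀ l ∉ S, a l = 0) ∧
      (∀ l ∈ S, (C *ᵥ a) l = (Pi.single j 1 : Fin p → ℝ) l) ∧ a ⬝ᵥ a ≤ κ⁻¹ ^ 2 := by
  obtain ⟨a, ha, hCa⟩ := exists_restricted_solution hκ hC S (Pi.single j 1)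
  refine ⟨a, ha, hCa, ?_⟩
  have h1 := hC a
  rw [dotProduct_congr_of_support ha hCa, dotProduct_single, mul_one] at h1
  have h2 := (le_abs_self _).trans (abs_apply_le_sqrt_dotProduct a j)
  have h3 := dotProduct_self_nonneg' a
  have h4 := Real.sq_sqrt h3
  set s := √(a ⬝ᵥ a)
  have hs : 0 ≤ s := Real.sqrt_nonneg _
  rw [← h4] at h1 ⊢
  refine pow_le_pow_left₀ hs ?_ 2
  rw [← one_div, le_div_iff₀ hκ]
  by_contra! h
  have : 0 < s := by
    rcases hs.eq_or_lt with h0 | h0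
    · rw [← h0] at h; linarith
    · exact h0
  nlinarith

/-- A sup-norm bound for the solution of the perturbed restricted system `Γ u = e` on `S`. -/
theorem abs_restricted_solution_le {Γ C : Matrix (Fin p) (Fin p) ℝ} (hCH : C.IsHermitian)
    {κ α δ Δ ρ : ℝ} (hκ : 0 < κ) (hα : 0 < α) (hδ : 0 ≤ δ)
    {S : Finset (Fin p)} (hΔ : δ * √S.card ≤ Δ)
    (hC : ∀ v, κ * (v ⬝ᵥ v) ≤ v ⬝ᵥ (C *ᵥ v))
    (hΓ : ∀ v : Fin p → ℝ, (∀ j ∉ S, v j = 0) → α / 2 * (v ⬝ᵥ v) ≤ v ⬝ᵥ (Γ *ᵥ v))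
    (hD : ∀ x y : Fin p → ℝ, (∀ j ∉ S, x j = 0) → (∀ j ∉ S, y j = 0) →
      |x ⬝ᵥ ((Γ - C) *ᵥ y)| ≤ δ * (√(x ⬝ᵥ x) * √(y ⬝ᵥ y)))
    {e : Fin p → ℝ} (hρ : 0 ≤ ρ) (he : ∀ j, |e j| ≤ ρ) {a : Fin p → Fin p → ℝ}
    (haS : ∀ j, ∀ l ∉ S, a j l = 0)
    (ha : ∀ j, ∀ l ∈ S, (C *ᵥ a j) l = (Pi.single j 1 : Fin p → ℝ) l) (hae : ∀ j, |a j ⬝ᵥ e| ≤ ρ)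
    {u : Fin p → ℝ} (huS : ∀ j ∉ S, u j = 0) (hu : ∀ j ∈ S, (Γ *ᵥ u) j = e j) (j : Fin p) :
    |u j| ≤ ρ * (1 + 2 * Δ / (α * κ)) := by
  -- The population solution `u₀` has coordinates `a j ⬝ᵥ e`, bounded by `ρ` by assumption; only `w
  -- = u - u₀` is left to estimate.
  obtain ⟨u₀, hu₀S, hu₀⟩ := exists_restricted_solution hκ hC S e
  have h0 : |u₀ j| ≤ ρ := by
    have : u₀ j = a j ⬝ᵥ e := by
      calc u₀ j = u₀ ⬝ᵥ Pi.single j 1 := by rw [dotProduct_single, mul_one]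
        _ = u₀ ⬝ᵥ (C *ᵥ a j) := (dotProduct_congr_of_support hu₀S (ha j)).symm
        _ = a j ⬝ᵥ (C *ᵥ u₀) := dotProduct_mulVec_comm_of_isHermitian hCH _ _
        _ = a j ⬝ᵥ e := dotProduct_congr_of_support (haS j) hu₀
    rw [this]; exact hae j
  set w := u - u₀ with hw
  have hwS : ∀ j ∉ S, w j = 0 := fun j hj => by simp [hw, huS j hj, hu₀S j hj]
  have h1 : w ⬝ᵥ (Γ *ᵥ w) = -(w ⬝ᵥ ((Γ - C) *ᵥ u₀)) := by
    have e1 : w ⬝ᵥ (Γ *ᵥ u) = w ⬝ᵥ e := dotProduct_congr_of_support hwS hu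
    have e2 : w ⬝ᵥ (C *ᵥ u₀) = w ⬝ᵥ e := dotProduct_congr_of_support hwS hu₀
    have e3 : Γ *ᵥ w = Γ *ᵥ u - Γ *ᵥ u₀ := by rw [hw, Matrix.mulVec_sub]
    rw [e3, dotProduct_sub, e1, Matrix.sub_mulVec, dotProduct_sub, e2]
    ring
  have h2 : u₀ ⬝ᵥ (C *ᵥ u₀) ≤ ρ * (√S.card * √(u₀ ⬝ᵥ u₀)) := by
    rw [dotProduct_congr_of_support hu₀S hu₀, dotProduct_comm]
    refine (le_abs_self _).trans ((abs_dotProduct_le_mul_l1Norm he u₀).trans ?_)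
    gcongr
    rw [← Real.sqrt_mul (by positivity), l1Norm_eq_sum_of_support hu₀S]
    exact Real.le_sqrt_of_sq_le (sq_sum_abs_le S u₀)
  have h3 := (neg_le_abs _).trans (hD w u₀ hwS hu₀S)
  have h4 := hΓ w hwS
  have h5 := hC u₀
  rw [h1] at h4
  have s1 := Real.sq_sqrt (dotProduct_self_nonneg' w)
  have s2 := Real.sq_sqrt (dotProduct_self_nonneg' u₀)
  have h6 := abs_apply_le_sqrt_dotProduct w j
  set x := √(w ⬝ᵥ w)
  set y := √(u₀ ⬝ᵥ u₀)
  set z := √(S.card : ℝ)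
  have hx : 0 ≤ x := Real.sqrt_nonneg _
  have hy : 0 ≤ y := Real.sqrt_nonneg _
  have hz : 0 ≤ z := Real.sqrt_nonneg _
  rw [← s1] at h4
  rw [← s2] at h5
  have h7 : κ * y ≤ ρ * z := by
    rcases hy.eq_or_lt with h | h
    · rw [← h]; nlinarith [mul_nonneg hρ hz]
    · refine le_of_mul_le_mul_right ?_ h
      nlinarith
  have h8 : α / 2 * x ≤ δ * y := by
    rcases hx.eq_or_lt with h | h
    · rw [← h]; nlinarith [mul_nonneg hδ hy]
    · refine le_of_mul_le_mul_right ?_ h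
      nlinarith
  -- The chain is `‖w‖₂ ≤ (2δ/α)‖u₀‖₂` and `‖u₀‖₂ ≤ ρ√|S| / κ`. The factor `√|S|` lost in passing
  -- from the sup norm to the Euclidean norm is absorbed by `δ√|S| ≤ Δ`.
  have h9 : x ≤ ρ * (2 * Δ / (α * κ)) := by
    rw [mul_div_assoc', le_div_iff₀ (by positivity)]
    have e1 := mul_le_mul_of_nonneg_right h8 hκ.le
    have e2 := mul_le_mul_of_nonneg_left h7 hδ
    have e3 := mul_le_mul_of_nonneg_left hΔ hρ
    nlinarith
  have h10 : u j = u₀ j + w j := by simp [hw]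
  rw [h10]
  have := abs_add_le (u₀ j) (w j)
  linarith

end RestrictedInverse

/-! ### Probabilities of the exceptional events. -/

section GoodEvent

variable {Ω : Type*} [MeasurableSpace Ω] {P : Measure Ω} {n p : ℕ}
  {X W : Fin n → Ω → Fin p → ℝ} {ε : Fin n → Ω → ℝ}
  {covX covW : Matrix (Fin p) (Fin p) ℝ} {σx σw σε : ℝ≥0}

/-- The exceptional sets involve uncountably many vectors. Taking the complement of a measurable
hull avoids proving them measurable. -/
theorem exists_measurableSet_of_measureReal_le [IsProbabilityMeasure P] {N : Set Ω} {q : ℝ}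
    (hN : P.real N ≤ q) : ∃ E, MeasurableSet E ∧ 1 - q ≤ P.real E ∧ ∀ ω ∈ E, ω ∉ N := by
  refine ⟨(toMeasurable P N)ᶜ, (measurableSet_toMeasurable _ _).compl, ?_,
    fun ω hω h => hω (subset_toMeasurable P N h)⟩
  rw [probReal_compl_eq_one_sub (measurableSet_toMeasurable _ _), measureReal_def,
    measure_toMeasurable, ← measureReal_def]
  linarith

theorem ErrorsInVariables.measure_exists_gammaVec_deviation_le [IsProbabilityMeasure P]
    (h : ErrorsInVariables P X W ε covX covW σx σw σε) (hn : 0 < n) (hp : 2 ≤ p)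
    {βs : Fin p → ℝ} {r : ℝ≥0} (hβs : βs ⬝ᵥ βs ≤ r) {a : Fin p → Fin p → ℝ}
    (ha : ∀ j, a j ⬝ᵥ a j ≤ r) {c : ℝ≥0} (hc0 : 0 < c)
    (hc : r * σx ^ 2 + r * σw ^ 2 ≤ c) (hc' : σε ^ 2 + r * σw ^ 2 ≤ c)
    (hlog : 4 * Real.log p ≤ n) :
    P.real {ω | ¬ ∀ j, |a j ⬝ᵥ (gammaVec (observedDesign X W ω) (response X ε βs ω)
        - gammaMat (observedDesign X W ω) covW *ᵥ βs)| ≤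
        2 * productScale c * √(Real.log p / n)} ≤ 2 * Real.exp (-Real.log p) := by
  have hp' : (2 : ℝ) ≤ p := by exact_mod_cast hp
  have hn' : (0 : ℝ) < n := by exact_mod_cast hn
  have hl : 0 < Real.log p := Real.log_pos (by linarith)
  have hL := productScale_pos hc0
  -- Then `n t² = 4 log p`, more than enough for a union bound over `p` directions.
  set t := 2 * √(Real.log p / n) with ht
  have ht2 : t ^ 2 = 4 * (Real.log p / n) := by
    rw [ht, mul_pow, Real.sq_sqrt (by positivity)]; norm_num
  have ht0 : 0 ≤ t := by positivity
  have ht1 : t ≤ 1 := by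
    rw [← sq_le_one_iff₀ ht0, ht2, mul_div_assoc', div_le_one hn']
    exact hlog
  have hsub : {ω | ¬ ∀ j, |a j ⬝ᵥ (gammaVec (observedDesign X W ω) (response X ε βs ω)
        - gammaMat (observedDesign X W ω) covW *ᵥ βs)| ≤
        2 * productScale c * √(Real.log p / n)} ⊆ ⋃ j ∈ (Finset.univ : Finset (Fin p)),
      {ω | productScale c * t < |a j ⬝ᵥ (gammaVec (observedDesign X W ω) (response X ε βs ω)
        - gammaMat (observedDesign X W ω) covW *ᵥ βs)|} := by
    intro ω hω
    simp only [Set.mem_ofPred_eq, not_forall, not_le] at hω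
    obtain ⟨j, hj⟩ := hω
    refine Set.mem_biUnion (x := j) (Finset.mem_coe.2 (Finset.mem_univ j)) ?_
    rw [Set.mem_ofPred_eq]
    calc productScale c * t = 2 * productScale c * √(Real.log p / n) := by rw [ht]; ring
      _ < _ := hj
  refine (measureReal_mono hsub (measure_ne_top _ _)).trans
    ((measureReal_biUnion_finset_le _ _).trans ?_)
  calc _ ≤ ∑ _j : Fin p, 2 * Real.exp (-(n * t ^ 2)) :=
        Finset.sum_le_sum fun j _ =>
          h.measure_gammaVec_deviation_le hn (ha j) hβs hc0 hc hc' ht0 ht1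
    _ = 2 * (p * Real.exp (-(n * t ^ 2))) := by
        rw [Finset.sum_const, Finset.card_univ, Fintype.card_fin, nsmul_eq_mul]; ring
    _ ≤ 2 * Real.exp (-Real.log p) := by
        gcongr
        have e1 : (n : ℝ) * t ^ 2 = 4 * Real.log p := by rw [ht2]; field_simp
        rw [e1]
        nth_rewrite 1 [← Real.exp_log (show (0 : ℝ) < p by linarith)]
        rw [← Real.exp_add]
        exact Real.exp_le_exp.2 (by linarith)

theorem ErrorsInVariables.measure_support_deviation_le [IsProbabilityMeasure P]
    (h : ErrorsInVariables P X W ε covX covW σx σw σε) (hn : 0 < n) {k : ℕ} (hk : 0 < k)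
    {S : Finset (Fin p)} (hS : S.card ≤ k) {c : ℝ≥0} (hc0 : 0 < c)
    (hc : 4 * σx ^ 2 + 4 * σw ^ 2 ≤ c) (hkn : 9 * (k : ℝ) ≤ n) :
    P.real {ω | ¬ ∀ x y : Fin p → ℝ, (∀ j ∉ S, x j = 0) → (∀ j ∉ S, y j = 0) →
      |x ⬝ᵥ ((gammaMat (observedDesign X W ω) covW - covX) *ᵥ y)|
        ≤ productScale c * (3 * √(k / n)) * (√(x ⬝ᵥ x) * √(y ⬝ᵥ y))}
      ≤ 2 * Real.exp (-k) := by
  have hn' : (0 : ℝ) < n := by exact_mod_cast hn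
  set t := 3 * √((k : ℝ) / n) with ht
  have ht2 : t ^ 2 = 9 * (k / n) := by
    rw [ht, mul_pow, Real.sq_sqrt (by positivity)]; norm_num
  have ht0 : 0 ≤ t := by positivity
  have ht1 : t ≤ 1 := by
    rw [← sq_le_one_iff₀ ht0, ht2, mul_div_assoc', div_le_one hn']
    exact hkn
  have hmain := h.measure_sparse_deviation_le hn S hk hc0 hc ht0 ht1 (q := 1 / 2) (by norm_num)
    le_rfl
  refine (measureReal_mono ?_ (measure_ne_top _ _)).trans (hmain.trans ?_)
  · intro ω hω hcon
    exact hω fun x y hx hy => hcon S subset_rfl hS x y hx hy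
  · have e1 : (n : ℝ) * t ^ 2 = 9 * k := by rw [ht2]; field_simp
    -- The squared net size is at most `(2⁴ · 3)^(2k) = 2304^k < e^(8k)`, while `t` was chosen with
    -- `n t² = 9k`; a factor `e^(-k)` remains.
    have e2 : (((1 / 2 : ℝ)⁻¹) ^ (4 * k) * (1 + 4 * (1 / 2)) ^ S.card) ^ 2 ≤ Real.exp (8 * k) := by
      calc (((1 / 2 : ℝ)⁻¹) ^ (4 * k) * (1 + 4 * (1 / 2)) ^ S.card) ^ 2
          ≤ (((1 / 2 : ℝ)⁻¹) ^ (4 * k) * (1 + 4 * (1 / 2)) ^ k) ^ 2 := by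
            gcongr
            norm_num
        _ = (2304 : ℝ) ^ k := by
            rw [pow_mul, ← mul_pow, ← pow_mul, mul_comm k 2, pow_mul]; norm_num
        _ ≤ (Real.exp 1 ^ 8) ^ k := by
            gcongr
            have := Real.exp_one_gt_d9
            calc (2304 : ℝ) ≤ 2.7 ^ 8 := by norm_num
              _ ≤ _ := by gcongr; linarith
        _ = Real.exp (8 * k) := by
            rw [← pow_mul, ← Real.exp_nat_mul]; push_cast; ring_nf
    rw [e1]
    calc _ ≤ Real.exp (8 * k) * (2 * Real.exp (-(9 * k))) := by gcongr
      _ = 2 * (Real.exp (8 * k) * Real.exp (-(9 * k))) := by ring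
      _ = 2 * Real.exp (-k) := by rw [← Real.exp_add]; ring_nf

theorem ErrorsInVariables.measure_restrictedEigenvalue_le [IsProbabilityMeasure P]
    (h : ErrorsInVariables P X W ε covX covW σx σw σε) (hn : 0 < n) (hp : 2 ≤ p)
    {c : ℝ≥0} (hc0 : 0 < c) (hc : 4 * σx ^ 2 + 4 * σw ^ 2 ≤ c) {t : ℝ} (ht0 : 0 < t) (ht1 : t ≤ 1)
    (hlog : 64 / t ^ 2 * Real.log p ≤ n) :
    P.real {ω | ¬ ∀ v : Fin p → ℝ, -(productScale c * t * (v ⬝ᵥ v))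
        - 64 * (productScale c * t) / t ^ 2 * (Real.log p / n) * l1Norm v ^ 2
        ≤ v ⬝ᵥ ((gammaMat (observedDesign X W ω) covW - covX) *ᵥ v)}
      ≤ 2 * Real.exp 8 * Real.exp (-Real.log p) := by
  have hp' : (2 : ℝ) ≤ p := by exact_mod_cast hp
  have hp0 : (0 : ℝ) < p := by linarith
  have hn' : (0 : ℝ) < n := by exact_mod_cast hn
  have hl : 0 < Real.log p := Real.log_pos (by linarith)
  have hL := productScale_pos hc0
  -- The sparsity level `m = ⌊x⌋` is the scale at which the squared net size, at most `p^(8m) e⁸`,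
  -- uses only half of the exponent `n t²`. From `x ≥ 4` follows `m - 1 ≥ x/2`, so `1/(m - 1)` is of
  -- order `log p / n`.
  set x := n * t ^ 2 / (16 * Real.log p) with hx
  have hnt : 64 * Real.log p ≤ n * t ^ 2 := by
    rwa [div_mul_eq_mul_div, div_le_iff₀ (by positivity)] at hlog
  have hx4 : 4 ≤ x := by rw [hx, le_div_iff₀ (by positivity)]; linarith
  set m := ⌊x⌋₊ with hm
  have hmx : (m : ℝ) ≤ x := Nat.floor_le (by linarith)
  have hxm : x < m + 1 := Nat.lt_floor_add_one x
  have hm2 : 2 ≤ m := Nat.le_floor (by push_cast; linarith)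
  have hmain := h.measure_sparse_deviation_le hn Finset.univ (s := m) (by omega) hc0 hc ht0.le ht1
    (q := (p : ℝ)⁻¹) (by positivity) (by rw [one_div]; gcongr)
  refine (measureReal_mono ?_ (measure_ne_top _ _)).trans (hmain.trans ?_)
  · intro ω hω hcon
    refine hω fun v => ?_
    have hq := quadForm_ge_of_sparse_bilin_le hm2
      (fun T hT => hcon T (Finset.subset_univ T) hT) v
    refine le_trans ?_ hq
    have e1 : 2 * (productScale c * t) / (m - 1)
        ≤ 64 * (productScale c * t) / t ^ 2 * (Real.log p / n) := by
      have e2 : 64 * (productScale c * t) / t ^ 2 * (Real.log p / n)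
          = 2 * (productScale c * t) / (x / 2) := by
        rw [hx]; field_simp; norm_num
      rw [e2]
      gcongr
      linarith
    have e3 := mul_le_mul_of_nonneg_right e1 (sq_nonneg (l1Norm v))
    have e4 : 2 * (productScale c * t) * l1Norm v ^ 2 / (m - 1)
      = 2 * (productScale c * t) / (m - 1) * l1Norm v ^ 2 := by ring
    rw [e4]
    linarith
  · have e1 : (((p : ℝ)⁻¹)⁻¹) ^ (4 * m) ≤ Real.exp (n * t ^ 2 / 4) := by
      rw [inv_inv, ← Real.exp_log hp0, ← Real.exp_nat_mul, Real.exp_le_exp]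
      push_cast
      have := mul_le_mul_of_nonneg_right hmx hl.le
      have e2 : x * Real.log p = n * t ^ 2 / 16 := by rw [hx]; field_simp
      linarith
    have e2 : (1 + 4 * (p : ℝ)⁻¹) ^ (Finset.univ : Finset (Fin p)).card ≤ Real.exp 4 := by
      rw [Finset.card_univ, Fintype.card_fin]
      calc (1 + 4 * (p : ℝ)⁻¹) ^ p ≤ Real.exp (4 * (p : ℝ)⁻¹) ^ p := by
            gcongr
            rw [add_comm]
            exact Real.add_one_le_exp _
        _ = Real.exp 4 := by
            rw [← Real.exp_nat_mul]; congr 1; field_simp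
    calc _ ≤ (Real.exp (n * t ^ 2 / 4) * Real.exp 4) ^ 2 * (2 * Real.exp (-(n * t ^ 2))) := by
          gcongr
      _ = 2 * Real.exp 8 * Real.exp (-(n * t ^ 2 / 2)) := by
          rw [mul_pow, ← Real.exp_nat_mul, ← Real.exp_nat_mul]
          have : Real.exp (((2 : ℕ) : ℝ) * (n * t ^ 2 / 4)) * Real.exp (((2 : ℕ) : ℝ) * 4)
              * (2 * Real.exp (-(n * t ^ 2)))
              = 2 * Real.exp (((2 : ℕ) : ℝ) * 4) * (Real.exp (((2 : ℕ) : ℝ) * (n * t ^ 2 / 4))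
                * Real.exp (-(n * t ^ 2))) := by ring
          rw [this, ← Real.exp_add]
          push_cast
          ring_nf
      _ ≤ _ := by
          gcongr
          linarith

end GoodEvent

end CorruptedLasso

/-! ### Choice of constants and assembly. -/

theorem mainTheorem4
    (σx σw σε : ℝ≥0) (κ b : ℝ) (hκ : 0 < κ) :
    ∃ c₀ > (0 : ℝ), ∃ c₁ > (0 : ℝ), ∃ c₂ > (0 : ℝ), ∃ c₃ > (0 : ℝ),
    ∀ η < (1 : ℝ), ∃ cl > (0 : ℝ), ∃ cu > (0 : ℝ),
    ∀ (Ω : Type*) [MeasurableSpace Ω] (P : Measure Ω) [IsProbabilityMeasure P]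
      (n p k : ℕ) (X W : Fin n → Ω → Fin p → ℝ) (ε : Fin n → Ω → ℝ)
      (covX covW : Matrix (Fin p) (Fin p) ℝ) (βs : Fin p → ℝ) (lam R cinf : ℝ),
      ErrorsInVariables P X W ε covX covW σx σw σε →
      -- the smallest eigenvalue of the covariance matrix of the covariates is at least `κ`
      (∀ μ ∈ spectrum ℝ covX, κ ≤ μ) →
      (supp βs).card ≤ k →
      ‖WithLp.toLp 2 βs‖ ≤ b →
      (k : ℝ) ^ 2 ≤ n →
      c₀ * k * Real.log p ≤ n →
      0 < R →
      l1Norm βs ≤ R / 2 →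
      cl * √(Real.log p / n) ≤ lam →
      lam ≤ cu / R →
      ∃ E : Set Ω, MeasurableSet E ∧
        1 - c₁ * Real.exp (-c₂ * min (k : ℝ) (Real.log p)) ≤ P.real E ∧
        ∀ ω ∈ E,
          let Z := observedDesign X W ω
          let y := response X ε βs ω
          let Γ := gammaMat Z covW
          let L := quadLoss Γ (gammaVec Z y)
          let ΓSS := Γ.toBlock (· ∈ supp βs) (· ∈ supp βs)
          let ΓScS := Γ.toBlock (· ∉ supp βs) (· ∈ supp βs)
          IsUnit ΓSS.det →
          opNormInf ΓSS⁻¹ ≤ cinf →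
          opNormInf (ΓScS * ΓSS⁻¹) ≤ η →
          ∃ βhat : Fin p → ℝ,
            (∀ β, IsStationaryPoint L (fun u => lam * |u|) R β ↔ β = βhat) ∧
            (∀ β, IsGlobalOptimum L (fun u => lam * |u|) R β ↔ β = βhat) ∧
            supp βhat ⊆ supp βs ∧
            -- the norm on `Fin p → ℝ` is the sup norm
            ‖βhat - βs‖ ≤ c₃ * √(Real.log p / n) + cinf * lam := by
  -- A common bound for the squared lengths of all directions used: lattice vectors (`4`), unit
  -- vectors (`1`), inverse columns (`κ⁻²`) and `β*` (`b²`).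
  set r : ℝ≥0 := 5 + (κ⁻¹ ^ 2).toNNReal + (b ^ 2).toNNReal with hr
  set c : ℝ≥0 := r * σx ^ 2 + r * σw ^ 2 + σε ^ 2 + 1 with hcdef
  have hc0 : 0 < c := by positivity
  have hc : r * σx ^ 2 + r * σw ^ 2 ≤ c := by
    rw [hcdef, add_assoc]; exact le_self_add
  have hc' : σε ^ 2 + r * σw ^ 2 ≤ c := by
    have : c = σε ^ 2 + r * σw ^ 2 + (r * σx ^ 2 + 1) := by rw [hcdef]; ring
    rw [this]; exact le_self_add
  have hrcoe : (r : ℝ) = 5 + κ⁻¹ ^ 2 + b ^ 2 := by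
    rw [hr]; push_cast
    rw [Real.coe_toNNReal _ (by positivity), Real.coe_toNNReal _ (by positivity)]
  have hc4 : 4 * σx ^ 2 + 4 * σw ^ 2 ≤ c := by
    refine le_trans ?_ hc
    have : 4 ≤ r := by
      rw [← NNReal.coe_le_coe, hrcoe]; push_cast; linarith [sq_nonneg κ⁻¹, sq_nonneg b]
    gcongr
  clear_value c r
  set L := productScale c with hL
  have hL0 : 0 < L := productScale_pos hc0
  -- The deviation level for the restricted eigenvalue bound: `L t ≤ κ/2` costs at most half of the
  -- curvature `κ`.
  set t := min 1 (κ / (2 * L)) with ht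
  have ht0 : 0 < t := lt_min one_pos (by positivity)
  have ht1 : t ≤ 1 := min_le_left _ _
  have hLt : L * t ≤ κ / 2 := by
    calc L * t ≤ L * (κ / (2 * L)) := by gcongr; exact min_le_right _ _
      _ = κ / 2 := by field_simp
  have hT : 256 ≤ 256 / t ^ 2 := by
    rw [le_div_iff₀ (by positivity)]; nlinarith
  clear_value t
  refine ⟨256 / t ^ 2, by positivity, 6 + 2 * Real.exp 8, by positivity, 1, one_pos,
    2 * L * (1 + 2 * (3 * L) / (κ / 2 * κ)), by positivity, fun η hη => ?_⟩
  have hη' : 0 < 1 - η := by linarith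
  -- The two summands give `ρ ≤ λ/4` and `ρ ≤ λ(1 - η)/4` for the noise level `ρ = 2L√(log p / n)`.
  -- The choice of `c_u` below then makes `4τR ≤ λ(1 - η)/2`.
  set cl := 8 * L + 8 * L / (1 - η) with hcl
  have hcl0 : 0 < cl := by positivity
  refine ⟨cl, hcl0, (1 - η) * cl ^ 2 * t ^ 2 / (256 * κ), by positivity, ?_⟩
  intro Ω _ P _ n p k X W ε covX covW βs lam R cinf h hspec hS hb hkn hklog hR hβs hlam hlamR
  -- Here the minimum in the exponent is at most `0` (with `Real.log 0 = 0` for `p = 0`) and `c₁ ≥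
  -- 1`, so the probability bound is vacuous and the empty event suffices.
  by_cases htriv : k = 0 ∨ p ≤ 1
  · refine ⟨∅, MeasurableSet.empty, ?_, fun ω hω => hω.elim⟩
    have hmin : min (k : ℝ) (Real.log p) ≤ 0 := by
      rcases htriv with h | h
      · exact (min_le_left _ _).trans (by simp [h])
      · exact (min_le_right _ _).trans
          (Real.log_nonpos (by positivity) (by exact_mod_cast h))
    have h1 : 1 ≤ Real.exp (-1 * min (k : ℝ) (Real.log p)) := Real.one_le_exp (by linarith)
    rw [measureReal_empty, sub_nonpos]
    exact one_le_mul_of_one_le_of_one_le (by linarith [Real.exp_pos 8]) h1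
  push Not at htriv
  obtain ⟨hk0, hp⟩ := htriv
  have hk : 0 < k := Nat.pos_of_ne_zero hk0
  have hk1 : (1 : ℝ) ≤ k := by exact_mod_cast hk
  have hn' : (0 : ℝ) < n := lt_of_lt_of_le (by positivity) hkn
  have hn : 0 < n := by exact_mod_cast hn'
  have hp' : (2 : ℝ) ≤ p := by exact_mod_cast hp
  have hl2 : 0.6 < Real.log p := by
    have := Real.log_two_gt_d9
    have := Real.log_le_log (by norm_num) hp'
    linarith
  have hl : 0 < Real.log p := by linarith
  have hlogn : 256 / t ^ 2 * Real.log p ≤ n := by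
    refine le_trans ?_ hklog
    rw [mul_assoc]
    refine mul_le_mul_of_nonneg_left ?_ (by positivity)
    exact le_mul_of_one_le_left hl.le hk1
  have hklog' : 256 * (k * Real.log p) ≤ n := by
    refine le_trans ?_ hklog
    rw [mul_assoc]
    gcongr
  have hkl : (k : ℝ) * 0.6 ≤ k * Real.log p := by gcongr
  have hlk : Real.log p ≤ k * Real.log p := le_mul_of_one_le_left hl.le hk1
  have hk9 : 9 * (k : ℝ) ≤ n := by linarith
  have hlog4 : 4 * Real.log p ≤ n := by linarith
  have hlog64 : 64 / t ^ 2 * Real.log p ≤ n := by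
    refine le_trans ?_ hlogn
    gcongr
    norm_num
  have hcovX := quadForm_ge_of_spectrum (h.isHermitian_covX hn) hspec
  have hβsr : βs ⬝ᵥ βs ≤ r := by
    have h1 : βs ⬝ᵥ βs = ‖WithLp.toLp 2 βs‖ ^ 2 := by
      rw [EuclideanSpace.norm_sq_eq]
      simp [dotProduct, sq]
    have h2 : ‖WithLp.toLp 2 βs‖ ^ 2 ≤ b ^ 2 := pow_le_pow_left₀ (norm_nonneg _) hb 2
    rw [h1, hrcoe]
    linarith [sq_nonneg κ⁻¹]
  choose a haS haC ha using exists_restricted_inverse_column hκ hcovX (supp βs)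
  have har : ∀ j, a j ⬝ᵥ a j ≤ r := fun j => by
    rw [hrcoe]; linarith [ha j, sq_nonneg b]
  have hsr : ∀ j : Fin p, (Pi.single j 1 : Fin p → ℝ) ⬝ᵥ Pi.single j 1 ≤ r := fun j => by
    rw [hrcoe, single_dotProduct, Pi.single_eq_same, one_mul]
    linarith [sq_nonneg κ⁻¹, sq_nonneg b]
  have b1 := h.measure_exists_gammaVec_deviation_le hn hp hβsr hsr hc0 hc hc' hlog4
  have b2 := h.measure_exists_gammaVec_deviation_le hn hp hβsr har hc0 hc hc' hlog4
  have b3 := h.measure_support_deviation_le hn hk hS hc0 hc4 hk9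
  have b4 := h.measure_restrictedEigenvalue_le hn hp hc0 hc4 ht0 ht1 hlog64
  set N1 := {ω | ¬ ∀ j, |(Pi.single j 1 : Fin p → ℝ) ⬝ᵥ (gammaVec (observedDesign X W ω)
    (response X ε βs ω) - gammaMat (observedDesign X W ω) covW *ᵥ βs)| ≤
        2 * productScale c * √(Real.log p / n)} with hN1
  set N2 := {ω | ¬ ∀ j, |a j ⬝ᵥ (gammaVec (observedDesign X W ω)
    (response X ε βs ω) - gammaMat (observedDesign X W ω) covW *ᵥ βs)| ≤
        2 * productScale c * √(Real.log p / n)} with hN2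
  set N3 := {ω | ¬ ∀ x y : Fin p → ℝ, (∀ j ∉ supp βs, x j = 0) → (∀ j ∉ supp βs, y j = 0) →
      |x ⬝ᵥ ((gammaMat (observedDesign X W ω) covW - covX) *ᵥ y)|
        ≤ productScale c * (3 * √(k / n)) * (√(x ⬝ᵥ x) * √(y ⬝ᵥ y))} with hN3
  set N4 := {ω | ¬ ∀ v : Fin p → ℝ, -(productScale c * t * (v ⬝ᵥ v))
        - 64 * (productScale c * t) / t ^ 2 * (Real.log p / n) * l1Norm v ^ 2
        ≤ v ⬝ᵥ ((gammaMat (observedDesign X W ω) covW - covX) *ᵥ v)} with hN4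
  have hprob : P.real (N1 ∪ N2 ∪ N3 ∪ N4)
      ≤ (6 + 2 * Real.exp 8) * Real.exp (-1 * min (k : ℝ) (Real.log p)) := by
    have u1 := measureReal_union_le (μ := P) (N1 ∪ N2 ∪ N3) N4
    have u2 := measureReal_union_le (μ := P) (N1 ∪ N2) N3
    have u3 := measureReal_union_le (μ := P) N1 N2
    have m1 : Real.exp (-Real.log p) ≤ Real.exp (-1 * min (k : ℝ) (Real.log p)) :=
      Real.exp_le_exp.2 (by linarith [min_le_right (k : ℝ) (Real.log p)])
    have m2 : Real.exp (-(k : ℝ)) ≤ Real.exp (-1 * min (k : ℝ) (Real.log p)) :=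
      Real.exp_le_exp.2 (by linarith [min_le_left (k : ℝ) (Real.log p)])
    have m3 := mul_le_mul_of_nonneg_left m1 (show 0 ≤ 2 * Real.exp 8 by positivity)
    linarith
  obtain ⟨E, hE, hPE, hEN⟩ := exists_measurableSet_of_measureReal_le hprob
  refine ⟨E, hE, hPE, fun ω hω => ?_⟩
  have hgood := hEN ω hω
  simp only [Set.mem_union, not_or] at hgood
  obtain ⟨⟨⟨g1, g2⟩, g3⟩, g4⟩ := hgood
  replace g1 := not_not.1 g1
  replace g2 := not_not.1 g2
  replace g3 := not_not.1 g3
  replace g4 := not_not.1 g4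
  intro Z y Γ Loss ΓSS ΓScS hdet hcinf hinc
  set s := √(Real.log p / n) with hs
  have hs2 : s ^ 2 = Real.log p / n := Real.sq_sqrt (by positivity)
  have hs0 : 0 < s := Real.sqrt_pos.2 (by positivity)
  have hlam0 : 0 < lam := lt_of_lt_of_le (by positivity) hlam
  have hΓ : Γ.IsHermitian := by
    refine Matrix.IsHermitian.sub ?_ (h.isHermitian_covW hn)
    have := Matrix.isHermitian_conjTranspose_mul_self Z
    simp only [Matrix.conjTranspose_eq_transpose_of_trivial] at this
    exact this.smul (IsSelfAdjoint.all _)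
  -- The tolerance is `τ = T s²` with `s² = log p / n`; here `64 L t ≤ 32 κ`. The constant `c₀ =
  -- 256/t²` is what `4τk ≤ κ/2` requires.
  set T := 32 * κ / t ^ 2 with hTdef
  have hRE : ∀ v, κ / 2 * (v ⬝ᵥ v) - T * s ^ 2 * l1Norm v ^ 2 ≤ v ⬝ᵥ (Γ *ᵥ v) := by
    intro v
    have e1 := g4 v
    have e2 := hcovX v
    rw [Matrix.sub_mulVec, dotProduct_sub] at e1
    have e3 := mul_le_mul_of_nonneg_right hLt (dotProduct_self_nonneg' v)
    have e4 : 64 * (L * t) / t ^ 2 * (Real.log p / n) * l1Norm v ^ 2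
        ≤ T * s ^ 2 * l1Norm v ^ 2 := by
      rw [hs2, hTdef]
      have : 64 * (L * t) ≤ 32 * κ := by linarith
      gcongr
    linarith
  have hScard : ((supp βs).card : ℝ) ≤ k := by exact_mod_cast hS
  have hST : 4 * (T * s ^ 2) * (supp βs).card ≤ κ / 2 := by
    have e1 : 256 / t ^ 2 * (k * (Real.log p / n)) ≤ 1 := by
      rw [← mul_div_assoc, ← mul_div_assoc, div_le_one hn', ← mul_assoc]
      exact hklog
    calc 4 * (T * s ^ 2) * (supp βs).card ≤ 4 * (T * s ^ 2) * k := by gcongr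
      _ = κ / 2 * (256 / t ^ 2 * (k * (Real.log p / n))) := by rw [hs2, hTdef]; ring
      _ ≤ κ / 2 * 1 := by gcongr
      _ = κ / 2 := mul_one _
  have hRT : 4 * (T * s ^ 2) * R ≤ lam * (1 - η) / 2 := by
    have e1 : cl * s * R ≤ (1 - η) * cl ^ 2 * t ^ 2 / (256 * κ) :=
      (mul_le_mul_of_nonneg_right hlam hR.le).trans ((le_div_iff₀ hR).1 hlamR)
    have e2 : 4 * T * s * R ≤ cl * ((1 - η) / 2) := by
      have : 4 * T * s * R = 128 * κ / (t ^ 2 * cl) * (cl * s * R) := by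
        rw [hTdef]; field_simp; norm_num
      rw [this]
      calc 128 * κ / (t ^ 2 * cl) * (cl * s * R)
          ≤ 128 * κ / (t ^ 2 * cl) * ((1 - η) * cl ^ 2 * t ^ 2 / (256 * κ)) := by gcongr
        _ = cl * ((1 - η) / 2) := by field_simp; norm_num
    calc 4 * (T * s ^ 2) * R = 4 * T * s * R * s := by ring
      _ ≤ cl * ((1 - η) / 2) * s := by gcongr
      _ = cl * s * ((1 - η) / 2) := by ring
      _ ≤ lam * ((1 - η) / 2) := by gcongr
      _ = _ := by ring
  have hcls : 8 * L * s + 8 * L / (1 - η) * s ≤ lam := by rw [← add_mul]; exact hlam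
  have hρ1 : 2 * L * s ≤ lam / 4 := by
    have : 0 ≤ 8 * L / (1 - η) * s := by positivity
    linarith
  have hρ2 : 2 * L * s ≤ lam * (1 - η) / 4 := by
    have e1 : 8 * L / (1 - η) * s ≤ lam := by
      have : 0 ≤ 8 * L * s := by positivity
      linarith
    have e2 := mul_le_mul_of_nonneg_right e1 hη'.le
    have e3 : 8 * L / (1 - η) * s * (1 - η) = 8 * L * s := by field_simp
    linarith
  have he : ∀ j, |(gammaVec Z y - Γ *ᵥ βs) j| ≤ 2 * L * s := fun j => by
    have := g1 j
    rwa [single_dotProduct, one_mul] at this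
  -- The sample size condition `n ≥ k²` enters here, as `√(k/n) · √k ≤ 1`.
  have hΔ : L * (3 * √(k / n)) * √(supp βs).card ≤ 3 * L := by
    have e1 : √((k : ℝ) / n) * √(supp βs).card ≤ 1 := by
      rw [← Real.sqrt_mul (by positivity), Real.sqrt_le_iff, and_iff_right zero_le_one, one_pow,
        div_mul_eq_mul_div,
        div_le_one hn']
      refine le_trans ?_ hkn
      rw [sq]
      gcongr
    calc L * (3 * √(k / n)) * √(supp βs).card = 3 * L * (√(k / n) * √(supp βs).card) := by ring
      _ ≤ 3 * L * 1 := by gcongr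
      _ = 3 * L := mul_one _
  have hfinal := lasso_unique_of_deterministic hΓ (γ := gammaVec Z y) (cinf := cinf)
    (r := 2 * L * s * (1 + 2 * (3 * L) / (κ / 2 * κ))) (by positivity) (half_pos hκ) hRE hST hRT
    (by positivity) hη hlam0 hR hβs (by positivity) he hρ1 hρ2
    (fun u huS hu => abs_restricted_solution_le (h.isHermitian_covX hn) hκ (half_pos hκ)
      (by positivity) hΔ hcovX
      (fun v hv => quadForm_ge_of_support (by positivity) hRE hST hv) g3 (by positivity) he haS haC
      g2 huS hu) hdet hcinf hinc
  obtain ⟨βhat, q1, q2, q3, q4⟩ := hfinal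
  refine ⟨βhat, q1, q2, q3, q4.trans (le_of_eq ?_)⟩
  ring
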